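/- Let $d,D\ge 1$ be integers, let $K\subset\mathbb R^d$ be a compact set of positive Lebesgue measure, and let $N>0$. Let $0<r\le\infty$ with $\operatorname{diam}(K)<r$, and let $q:[0,r)\to[0,\infty)$ be a gauge function, i.e. $q$ is continuous and strictly increasing with $q(0)=0$. Write $q^{-1}(\tau)=\sup\{s\in[0,r): q(s)\le\tau\}\in[0,\infty]$ for $\tau\ge 0$ (this is the inverse function of $q$ on the range of $q$, and it equals $r$ above the range), and for $\tau>0$ put $$ g_q(\tau)=\frac{\tau^D}{(q^{-1}(\tau))^d},\qquad v_q(\tau)=\int_{q^{-1}(\tau)}^{\operatorname{diam}(K)} q(\rho)^{-D}\rho^{d-1}\,d\rho , $$ the integral being $0$ if $q^{-1}(\tau)\ge\operatorname{diam}(K)$. Assume that $$ \sup_{\tau\in(0,\operatorname{diam}(K)]} v_q(\tau)\,g_q(\tau)\in(0,\infty). $$ Let $M=\{M(x)=(M_1(x),\dots,M_D(x)),\ x\in\mathbb R^d\}$ be a $D$-dimensional Gaussian process on a probability space $(\Omega,\mathcal F,P)$, with independent and identically distributed components (as processes), whose sample paths are almost surely continuous on $K$. Put $f(x)=E(M(x))$,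 $\tilde M=M-f$. Assume the hypotheses $(H_M)$: there are positive constants $c_1,c_2,c_3,\eta,a,b,L$ such that for all $x,\bar x\in K$ 1. $c_1\le \operatorname{Var}(M_1(x))\le c_2$; 2. $\operatorname{Corr}(M_1(x),M_1(\bar x))<1$ if $x\ne\bar x$; 3. $|\operatorname{Var}(M_1(x))-\operatorname{Var}(M_1(\bar x))|\le c_3\,\|M_1(x)-M_1(\bar x)\|_{L^2(\Omega)}^{1+\eta}$; 4. $a\,q(|x-\bar x|)\le\|\tilde M_1(x)-\tilde M_1(\bar x)\|_{L^2(\Omega)}\le b\,q(|x-\bar x|)$ and $|f(x)-f(\bar x)|\le L\,q(|x-\bar x|)$. Then there is a constant $C>0$, which depends only on $d,D,K,N$, on the restriction of $f$ to $K$, on $q$ (with its domain $[0,r)$), and on the constants in $(H_M)$, such that for every Borel set $A\subset B_N(0)=\{y\in\mathbb R^D:|y|<N\}$, $$ P\{M(K)\cap A\ne\emptyset\}\ \ge\ C\,\mathrm{Cap}_{(g_q)^{-1}}(A). $$ Here $$\mathrm{Cap}_{(g_q)^{-1}}(A)=\Big[\inf_{\mu}\int_{\mathbb R^D\times\mathbb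 R^D} (g_q)^{-1}(|y-\bar y|)\,\mu(dy)\,\mu(d\bar y)\Big]^{-1},$$ the infimum is over all probability measures $\mu$ on $A$ (it is $\infty$ if there is none, and $1/\infty=0$), $(g_q)^{-1}(\tau)=1/g_q(\tau)\in(0,\infty]$ for $\tau>0$, and $(g_q)^{-1}(0)=\infty$. The probability is that of the completion of $P$ if the event is not in $\mathcal F$. -/

import Mathlib

open MeasureTheory ProbabilityTheory
open scoped ENNReal

noncomputable section

/-- `q` is a gauge function on `[0, r)`, `0 < r ≤ ∞`: strictly increasing, continuous, `q 0 = 0`.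
The values of `q` outside `[0, r)` are irrelevant. -/
structure IsGauge (r : ℝ≥0∞) (q : ℝ → ℝ) : Prop where
  pos : 0 < r
  strictMonoOn : StrictMonoOn q {s : ℝ | 0 ≤ s ∧ ENNReal.ofReal s < r}
  continuousOn : ContinuousOn q {s : ℝ | 0 ≤ s ∧ ENNReal.ofReal s < r}
  map_zero : q 0 = 0

/-- The inverse of a gauge function on `[0, r)`: `q⁻¹(τ) = sup {s ∈ [0, r) : q s ≤ τ}`, for `τ ≥ 0`.
This is the true inverse on the range of `q`, and it equals `r` for `τ` above the range. -/
def gaugeInv (r : ℝ≥0∞) (q : ℝ → ℝ) (τ : ℝ) : ℝ≥0∞ :=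
  ⨆ (s : ℝ) (_ : (0 ≤ s ∧ ENNReal.ofReal s < r) ∧ q s ≤ τ), ENNReal.ofReal s

/-- `g_q(τ) = τ ^ D / (q⁻¹(τ)) ^ d`, for `τ > 0`. -/
def gaugeG (d D : ℕ) (r : ℝ≥0∞) (q : ℝ → ℝ) (τ : ℝ) : ℝ≥0∞ :=
  ENNReal.ofReal τ ^ D / gaugeInv r q τ ^ d

/-- `v_q(τ) = ∫_{q⁻¹(τ)}^{δ} q(ρ) ^ (-D) ρ ^ (d - 1) dρ` (zero if `q⁻¹(τ) ≥ δ`); in the theorem,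
`δ` is the diameter of `K`. -/
def gaugeV (d D : ℕ) (r : ℝ≥0∞) (q : ℝ → ℝ) (δ τ : ℝ) : ℝ≥0∞ :=
  ∫⁻ ρ in {ρ : ℝ | gaugeInv r q τ < ENNReal.ofReal ρ ∧ ρ < δ},
    (ENNReal.ofReal (q ρ) ^ D)⁻¹ * ENNReal.ofReal ρ ^ (d - 1)

/-- The potential kernel `z ↦ 1 / g_q(|z|)` on `ℝ^D`, with the value `∞` at the origin. -/
def gaugeKernel (d D : ℕ) (r : ℝ≥0∞) (q : ℝ → ℝ) (z : EuclideanSpace ℝ (Fin D)) : ℝ≥0∞ :=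
  open Classical in if z = 0 then ∞ else (gaugeG d D r q ‖z‖)⁻¹

/-- The energy of a measure on `ℝ^D` relative to a kernel. -/
def energy {D : ℕ} (k : EuclideanSpace ℝ (Fin D) → ℝ≥0∞)
    (μ : Measure (EuclideanSpace ℝ (Fin D))) : ℝ≥0∞ :=
  ∫⁻ p, k (p.1 - p.2) ∂(μ.prod μ)

/-- The capacity of a Borel set `A` relative to a kernel: the inverse of the infimum of the energies
of the probability measures on `A` (it is `0` if `A` is empty). -/
def kernelCapacity {D : ℕ} (k : EuclideanSpace ℝ (Fin D) → ℝ≥0∞)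
    (A : Set (EuclideanSpace ℝ (Fin D))) : ℝ≥0∞ :=
  (⨅ (μ : Measure (EuclideanSpace ℝ (Fin D))) (_ : IsProbabilityMeasure μ ∧ μ Aᶜ = 0),
    energy k μ)⁻¹

section Field

variable {d D : ℕ} {Ω : Type*} [MeasurableSpace Ω]

/-- The components of the field are independent and identically distributed, as processes. -/
structure IIDComponents (P : Measure Ω)
    (M : EuclideanSpace ℝ (Fin d) → Ω → EuclideanSpace ℝ (Fin D)) : Prop where
  indep : iIndepFun (fun (j : Fin D) (ω : Ω) (x : EuclideanSpace ℝ (Fin d)) => M x ω j) P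
  identDistrib : ∀ i j : Fin D,
    IdentDistrib (fun (ω : Ω) (x : EuclideanSpace ℝ (Fin d)) => M x ω i)
      (fun (ω : Ω) (x : EuclideanSpace ℝ (Fin d)) => M x ω j) P P

/-- The norm of `L²(Ω)`. -/
def l2Norm (P : Measure Ω) (X : Ω → ℝ) : ℝ := (eLpNorm X 2 P).toReal

/-- The correlation coefficient. -/
def corr (P : Measure Ω) (X Y : Ω → ℝ) : ℝ :=
  cov[X, Y; P] / (Real.sqrt Var[X; P] * Real.sqrt Var[Y; P])

/-- The mean function `f(x) = E(M(x))`. -/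
def meanFn (P : Measure Ω) (M : EuclideanSpace ℝ (Fin d) → Ω → EuclideanSpace ℝ (Fin D))
    (x : EuclideanSpace ℝ (Fin d)) : EuclideanSpace ℝ (Fin D) :=
  ∫ ω, M x ω ∂P

/-- The first component `M₁`. -/
def comp₁ [NeZero D] (M : EuclideanSpace ℝ (Fin d) → Ω → EuclideanSpace ℝ (Fin D))
    (x : EuclideanSpace ℝ (Fin d)) (ω : Ω) : ℝ :=
  M x ω 0

/-- The centred first component `M₁(x) - E(M₁(x))`. -/
def centredComp₁ [NeZero D] (P : Measure Ω)
    (M : EuclideanSpace ℝ (Fin d) → Ω → EuclideanSpace ℝ (Fin D))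
    (x : EuclideanSpace ℝ (Fin d)) (ω : Ω) : ℝ :=
  M x ω 0 - meanFn P M x 0

/-- The hypotheses `(H_M)` on the set `K`, for the gauge function `q`, with the constants
`c₁, c₂` (bounds of the variance), `c₃, η` (regularity of the variance), `a, b` (comparison of the
canonical metric with `q`) and `L` (regularity of the mean). -/
structure HypHM [NeZero D] (P : Measure Ω)
    (M : EuclideanSpace ℝ (Fin d) → Ω → EuclideanSpace ℝ (Fin D))
    (K : Set (EuclideanSpace ℝ (Fin d))) (q : ℝ → ℝ) (c₁ c₂ c₃ η a b L : ℝ) : Prop where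
  var_bounds : ∀ x ∈ K, c₁ ≤ Var[comp₁ M x; P] ∧ Var[comp₁ M x; P] ≤ c₂
  corr_lt_one : ∀ x ∈ K, ∀ y ∈ K, x ≠ y → corr P (comp₁ M x) (comp₁ M y) < 1
  var_sub : ∀ x ∈ K, ∀ y ∈ K, |Var[comp₁ M x; P] - Var[comp₁ M y; P]| ≤
    c₃ * l2Norm P (fun ω => comp₁ M x ω - comp₁ M y ω) ^ (1 + η)
  metric_lower : ∀ x ∈ K, ∀ y ∈ K, a * q (dist x y) ≤
    l2Norm P (fun ω => centredComp₁ P M x ω - centredComp₁ P M y ω)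
  metric_upper : ∀ x ∈ K, ∀ y ∈ K,
    l2Norm P (fun ω => centredComp₁ P M x ω - centredComp₁ P M y ω) ≤ b * q (dist x y)
  mean_sub : ∀ x ∈ K, ∀ y ∈ K, dist (meanFn P M x) (meanFn P M y) ≤ L * q (dist x y)

end Field

end

/-! The proof is the second moment method. Fix a probability measure μ on A and let J_ε be the mass,
under Lebesgue measure on K times μ, of the pairs (x, y) with |M_i(x) - y_i| < ε for all i. Gaussian
densities with variance in [c₁, c₂] give E J_ε ≥ c ε^D. Once E J_ε² ≤ C ε^(2D) · energy(μ) is known,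
Cauchy–Schwarz bounds P(J_ε ≠ 0) below by c² / (C · energy(μ)), uniformly in ε. Continuity of paths
and compactness let ε tend to 0 (`le_measure_image_inter_nonempty`), and the supremum over μ
produces the capacity.

The second moment rests on two estimates. In `exists_measure_forall_abs_sub_lt_le`, the probability
that M(x), M(x') are ε-close to y, z is at most (C ε² / max(ρ, |y - z|))^D with ρ = q(|x - x'|):
regressing M₁(x) on M₁(x') leaves an independent Gaussian residual with standard deviation of order
ρ (`residual_variance_bounds`), whose density is at most of order 1/ρ and decays in |y - z|/ρ. In
`exists_lintegral_potential_le`, the integral of max(q(|x - x'|), τ)^(-D) over x' is at most of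
order 1/g_q(τ): radii below q⁻¹(τ) contribute at most a constant times τ^(-D) q⁻¹(τ)^d = 1/g_q(τ),
and radii above contribute v_q(τ), which the bound on v_q g_q controls by 1/g_q(τ).

The two-point estimate needs ρ small, so K is replaced by a compact piece of positive volume and
small diameter, and A by a compact piece of μ-mass above 1/2. Both only shrink the hitting event and
cost constants. -/

/-! ### Polar coordinates, the gauge and its potential -/

theorem lintegral_fun_norm_euclidean {d : ℕ} [NeZero d] {h : ℝ → ℝ≥0∞} (hh : Measurable h) :
    ∫⁻ x : EuclideanSpace ℝ (Fin d), h ‖x‖ =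
      (volume : Measure (EuclideanSpace ℝ (Fin d))).toSphere Set.univ *
        ∫⁻ ρ in Set.Ioi (0 : ℝ), ENNReal.ofReal ρ ^ (d - 1) * h ρ := by
  have hmp := (volume : Measure (EuclideanSpace ℝ (Fin d))).measurePreserving_homeomorphUnitSphereProd
  calc ∫⁻ x : EuclideanSpace ℝ (Fin d), h ‖x‖
      = ∫⁻ x in ({0}ᶜ : Set (EuclideanSpace ℝ (Fin d))), h ‖x‖ := by
        rw [restrict_compl_singleton]
    _ = ∫⁻ x : ({0}ᶜ : Set (EuclideanSpace ℝ (Fin d))), h ‖x.1‖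
          ∂((volume : Measure (EuclideanSpace ℝ (Fin d))).comap (↑)) := by
        rw [lintegral_subtype_comap (measurableSet_singleton _).compl fun x => h ‖x‖]
    _ = ∫⁻ x, h x.2.1 ∂((volume : Measure (EuclideanSpace ℝ (Fin d))).toSphere.prod
          (Measure.volumeIoiPow (Module.finrank ℝ (EuclideanSpace ℝ (Fin d)) - 1))) := by
        rw [← hmp.lintegral_comp_emb (Homeomorph.measurableEmbedding _)]
        simp
    _ = _ := by
        rw [lintegral_prod _ (by fun_prop)]
        simp only [lintegral_const, finrank_euclideanSpace, Fintype.card_fin]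
        rw [mul_comm, Measure.volumeIoiPow,
          lintegral_withDensity_eq_lintegral_mul _ (by fun_prop) (by fun_prop)]
        simp only [Pi.mul_apply]
        rw [lintegral_subtype_comap measurableSet_Ioi
          (fun y : ℝ => ENNReal.ofReal (y ^ (d - 1)) * h y)]
        congr 1
        refine setLIntegral_congr_fun measurableSet_Ioi fun y hy => ?_
        simp only [ENNReal.ofReal_pow (le_of_lt hy)]

theorem gaugeInv_mono {r : ℝ≥0∞} {q : ℝ → ℝ} {s t : ℝ} (h : s ≤ t) :
    gaugeInv r q s ≤ gaugeInv r q t :=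
  iSup_mono fun _ => iSup_le fun hx => le_iSup_of_le ⟨hx.1, hx.2.trans h⟩ le_rfl

theorem IsGauge.exists_pos_map_lt {r : ℝ≥0∞} {q : ℝ → ℝ} (hq : IsGauge r q) {τ : ℝ} (hτ : 0 < τ) :
    ∃ s : ℝ, 0 < s ∧ ENNReal.ofReal s < r ∧ q s < τ := by
  have h0 : (0 : ℝ) ∈ {s : ℝ | 0 ≤ s ∧ ENNReal.ofReal s < r} := by simp [hq.pos]
  have hc := hq.continuousOn 0 h0
  rw [ContinuousWithinAt, hq.map_zero] at hc
  have h1 : ∀ᶠ s in nhdsWithin (0 : ℝ) {s : ℝ | 0 ≤ s ∧ ENNReal.ofReal s < r}, q s < τ :=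
    hc.eventually (gt_mem_nhds hτ)
  rw [eventually_nhdsWithin_iff] at h1
  have h2 : ∀ᶠ s in nhds (0 : ℝ), ENNReal.ofReal s < r := by
    have : ContinuousAt ENNReal.ofReal 0 := ENNReal.continuous_ofReal.continuousAt
    exact this.eventually (gt_mem_nhds (by simpa using hq.pos))
  have h3 := ((h1.and h2).filter_mono (nhdsWithin_le_nhds (s := Set.Ioi 0))).and
    (self_mem_nhdsWithin (a := (0 : ℝ)) (s := Set.Ioi 0))
  obtain ⟨s, ⟨hs1, hs2⟩, hs0⟩ := h3.exists
  have hs0 : 0 < s := hs0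
  exact ⟨s, hs0, hs2, hs1 ⟨hs0.le, hs2⟩⟩

theorem gaugeInv_ne_zero {r : ℝ≥0∞} {q : ℝ → ℝ} (hq : IsGauge r q) {τ : ℝ} (hτ : 0 < τ) :
    gaugeInv r q τ ≠ 0 := by
  obtain ⟨s, hs0, hsr, hs⟩ := hq.exists_pos_map_lt hτ
  have : ENNReal.ofReal s ≤ gaugeInv r q τ :=
    le_iSup₂_of_le s ⟨⟨hs0.le, hsr⟩, hs.le⟩ le_rfl
  exact (lt_of_lt_of_le (ENNReal.ofReal_pos.2 hs0) this).ne'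

theorem measurable_gaugeKernel {d D : ℕ} {r : ℝ≥0∞} {q : ℝ → ℝ} :
    Measurable (gaugeKernel d D r q) := by
  have h1 : Measurable (gaugeInv r q) := Monotone.measurable fun _ _ h => gaugeInv_mono h
  have h2 : Measurable (gaugeG d D r q) := by unfold gaugeG; fun_prop
  classical
  unfold gaugeKernel
  exact Measurable.ite (measurableSet_singleton 0) measurable_const
    (h2.comp measurable_norm).inv

theorem gaugeV_anti {d D : ℕ} {r : ℝ≥0∞} {q : ℝ → ℝ} {δ s t : ℝ} (h : s ≤ t) :
    gaugeV d D r q δ t ≤ gaugeV d D r q δ s :=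
  lintegral_mono_set fun _ hx => ⟨(gaugeInv_mono h).trans_lt hx.1, hx.2⟩

theorem gaugeG_ne_top {d D : ℕ} {r : ℝ≥0∞} {q : ℝ → ℝ} (hq : IsGauge r q) {τ : ℝ} (hτ : 0 < τ) :
    gaugeG d D r q τ ≠ ∞ :=
  ENNReal.div_ne_top (ENNReal.pow_ne_top ENNReal.ofReal_ne_top)
    (pow_ne_zero _ (gaugeInv_ne_zero hq hτ))

theorem inv_gaugeG {d D : ℕ} {r : ℝ≥0∞} {q : ℝ → ℝ} {τ : ℝ} (hτ : 0 < τ) :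
    (gaugeG d D r q τ)⁻¹ = gaugeInv r q τ ^ d * (ENNReal.ofReal τ ^ D)⁻¹ := by
  rw [gaugeG, ENNReal.inv_div, div_eq_mul_inv]
  · exact Or.inr (ENNReal.pow_ne_top ENNReal.ofReal_ne_top)
  · exact Or.inr (pow_ne_zero _ (ENNReal.ofReal_pos.2 hτ).ne')

/-- The supremum covers only τ ≤ δ, while |y - z| ranges up to 2N. Beyond δ, v_q decreases and q⁻¹
increases, so the bound at δ carries over at the cost of the factor (T/δ)^D. -/
theorem exists_gaugeV_le {d D : ℕ} {r : ℝ≥0∞} {q : ℝ → ℝ} (hq : IsGauge r q) {δ : ℝ} (hδ : 0 < δ)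
    (hsup : (⨆ τ ∈ Set.Ioc (0 : ℝ) δ, gaugeV d D r q δ τ * gaugeG d D r q τ) < ∞) (T : ℝ) :
    ∃ C : ℝ, 0 < C ∧ ∀ τ, 0 < τ → τ < T →
      gaugeV d D r q δ τ ≤ ENNReal.ofReal C * (gaugeG d D r q τ)⁻¹ := by
  set S := ⨆ τ ∈ Set.Ioc (0 : ℝ) δ, gaugeV d D r q δ τ * gaugeG d D r q τ with hS
  have key : ∀ τ, 0 < τ → τ ≤ δ →
      gaugeV d D r q δ τ ≤ (S + 1) * (gaugeG d D r q τ)⁻¹ := by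
    intro τ h0 h1
    -- g_q(τ) = 0 means that q⁻¹(τ)^d is infinite. The right side is then ∞, because S + 1 is not 0.
    by_cases hg : gaugeG d D r q τ = 0
    · simp [hg]
    rw [← div_eq_mul_inv, ENNReal.le_div_iff_mul_le (Or.inl hg) (Or.inl (gaugeG_ne_top hq h0))]
    exact (le_iSup₂_of_le (f := fun τ (_ : τ ∈ Set.Ioc (0 : ℝ) δ) =>
      gaugeV d D r q δ τ * gaugeG d D r q τ) τ ⟨h0, h1⟩ le_rfl).trans le_self_add
  have hC1 : 1 ≤ max 1 (T / δ) := le_max_left _ _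
  refine ⟨(S + 1).toReal * max 1 (T / δ) ^ D, mul_pos (ENNReal.toReal_pos (by simp) ?_)
    (by positivity), fun τ h0 hT => ?_⟩
  · exact ENNReal.add_ne_top.2 ⟨hsup.ne, by simp⟩
  have hS1 : ENNReal.ofReal (S + 1).toReal = S + 1 :=
    ENNReal.ofReal_toReal (ENNReal.add_ne_top.2 ⟨hsup.ne, by simp⟩)
  rw [ENNReal.ofReal_mul ENNReal.toReal_nonneg, hS1, mul_assoc]
  rcases le_or_gt τ δ with h | h
  · refine (key τ h0 h).trans ?_
    gcongr
    refine le_mul_of_one_le_left (zero_le) ?_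
    rw [ENNReal.one_le_ofReal]
    exact one_le_pow₀ hC1
  · refine (gaugeV_anti h.le).trans ((key δ hδ le_rfl).trans ?_)
    gcongr
    rw [inv_gaugeG hδ, inv_gaugeG h0, ← mul_assoc, mul_comm (ENNReal.ofReal _) (_ ^ d), mul_assoc]
    refine mul_le_mul' (pow_le_pow_left' (gaugeInv_mono h.le) _) ?_
    rw [← ENNReal.ofReal_pow hδ.le, ← ENNReal.ofReal_pow h0.le,
      ← ENNReal.ofReal_inv_of_pos (by positivity), ← ENNReal.ofReal_inv_of_pos (by positivity),
      ← ENNReal.ofReal_mul (by positivity)]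
    refine ENNReal.ofReal_le_ofReal ?_
    rw [← inv_pow, ← inv_pow, ← mul_pow]
    refine pow_le_pow_left₀ (by positivity) ?_ _
    calc δ⁻¹ = τ / δ * τ⁻¹ := by field_simp
      _ ≤ _ := by
        gcongr
        exact (div_le_div_of_nonneg_right hT.le hδ.le).trans (le_max_right _ _)

theorem exists_lintegral_potential_le {d D : ℕ} [NeZero d] {r : ℝ≥0∞} {q : ℝ → ℝ}
    (hq : IsGauge r q) {δ : ℝ} (hδ : 0 < δ) (hr : ENNReal.ofReal δ < r)
    (hsup : (⨆ τ ∈ Set.Ioc (0 : ℝ) δ, gaugeV d D r q δ τ * gaugeG d D r q τ) < ∞) (T : ℝ) :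
    ∃ C : ℝ, 0 < C ∧ ∀ τ, 0 < τ → τ < T → ∀ (s : Set (EuclideanSpace ℝ (Fin d)))
      (x : EuclideanSpace ℝ (Fin d)), MeasurableSet s → (∀ z ∈ s, dist x z < δ) →
      ∫⁻ z in s, ((ENNReal.ofReal (max (q (dist x z)) τ)) ^ D)⁻¹ ≤
        ENNReal.ofReal C * (gaugeG d D r q τ)⁻¹ := by
  obtain ⟨C, hC, hCv⟩ := exists_gaugeV_le (d := d) (D := D) hq hδ hsup T
  set V := (volume : Measure (EuclideanSpace ℝ (Fin d))).toSphere Set.univ with hV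
  have hVt : V ≠ ∞ := measure_ne_top _ _
  have hVpos : 0 < V := by
    rw [hV, Measure.measure_univ_pos]
    have : Nontrivial (EuclideanSpace ℝ (Fin d)) := by
      have : Nonempty (Fin d) := ⟨0⟩
      infer_instance
    exact Measure.toSphere_ne_zero _
  -- V is the area of the unit sphere; C pays for radii above q⁻¹(τ), and 1 for radii below.
  refine ⟨V.toReal * (C + 1), mul_pos (ENNReal.toReal_pos hVpos.ne' hVt) (by linarith),
    fun τ h0 hT s x hs hsx => ?_⟩
  rw [ENNReal.ofReal_mul ENNReal.toReal_nonneg, ENNReal.ofReal_toReal hVt, mul_assoc]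
  by_cases hinf : gaugeInv r q τ = ∞
  · have : (gaugeG d D r q τ)⁻¹ = ∞ := by
      rw [inv_gaugeG h0, hinf, ENNReal.top_pow (NeZero.ne d), ENNReal.top_mul]
      simp
    rw [this, ENNReal.mul_top (by simp; linarith), ENNReal.mul_top hVpos.ne']
    exact le_top
  -- a measurable version of `q`
  set Q : ℝ → ℝ := Set.IccExtend hδ.le ((Set.Icc 0 δ).domRestrict q) with hQ
  have hIcc : Set.Icc 0 δ ⊆ {s : ℝ | 0 ≤ s ∧ ENNReal.ofReal s < r} := fun t ht =>
    ⟨ht.1, (ENNReal.ofReal_le_ofReal ht.2).trans_lt hr⟩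
  have hQc : Continuous Q :=
    (continuousOn_iff_continuous_domRestrict.1 (hq.continuousOn.mono hIcc)).Icc_extend'
  have hQq : ∀ t ∈ Set.Icc 0 δ, Q t = q t := fun t ht => by
    rw [hQ, Set.IccExtend_of_mem _ _ ht]; rfl
  set h : ℝ → ℝ≥0∞ := (Set.Iio δ).indicator
    (fun ρ => ((ENNReal.ofReal (max (Q ρ) τ)) ^ D)⁻¹) with hh
  have hhm : Measurable h := Measurable.indicator (by fun_prop) measurableSet_Iio
  have step1 : ∫⁻ z in s, ((ENNReal.ofReal (max (q (dist x z)) τ)) ^ D)⁻¹ ≤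
      ∫⁻ z : EuclideanSpace ℝ (Fin d), h ‖z‖ := by
    calc _ ≤ ∫⁻ z in s, h ‖z - x‖ := by
          refine setLIntegral_mono' hs fun z hz => le_of_eq ?_
          rw [← dist_eq_norm, dist_comm z x, hh, Set.indicator_of_mem (show dist x z ∈ Set.Iio δ from hsx z hz),
            hQq _ ⟨dist_nonneg, (hsx z hz).le⟩]
      _ ≤ ∫⁻ z, h ‖z - x‖ := setLIntegral_le_lintegral _ _
      _ = _ := lintegral_sub_right_eq_self (fun z => h ‖z‖) x
  refine step1.trans ?_
  rw [lintegral_fun_norm_euclidean hhm]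
  refine mul_le_mul' le_rfl ?_
  set R := (gaugeInv r q τ).toReal with hR
  have hRe : ENNReal.ofReal R = gaugeInv r q τ := ENNReal.ofReal_toReal hinf
  -- The maximum is bounded below by q(ρ) beyond R = q⁻¹(τ) and by τ up to R. There ρ^(d-1) ≤
  -- R^(d-1), so the near part integrates to τ^(-D) R^d = 1/g_q(τ).
  have hsub : ∀ ρ ∈ Set.Ioi (0 : ℝ), ENNReal.ofReal ρ ^ (d - 1) * h ρ ≤
      ({ρ : ℝ | gaugeInv r q τ < ENNReal.ofReal ρ ∧ ρ < δ}.indicator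
        (fun ρ => (ENNReal.ofReal (q ρ) ^ D)⁻¹ * ENNReal.ofReal ρ ^ (d - 1)) ρ) +
      (Set.Ioc 0 R).indicator
        (fun _ => (ENNReal.ofReal τ ^ D)⁻¹ * ENNReal.ofReal R ^ (d - 1)) ρ := by
    intro ρ hρ
    have hρ : 0 < ρ := hρ
    by_cases h1 : ρ < δ
    · rw [hh, Set.indicator_of_mem (show ρ ∈ Set.Iio δ from h1), hQq ρ ⟨hρ.le, h1.le⟩, mul_comm]
      by_cases h2 : gaugeInv r q τ < ENNReal.ofReal ρ
      · have hmem : ρ ∈ {ρ : ℝ | gaugeInv r q τ < ENNReal.ofReal ρ ∧ ρ < δ} := ⟨h2, h1⟩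
        rw [Set.indicator_of_mem hmem]
        refine le_trans ?_ le_self_add
        gcongr
        exact le_max_left _ _
      · have h3 : ρ ≤ R := by
          rw [not_lt, ← hRe, ENNReal.ofReal_le_ofReal_iff ENNReal.toReal_nonneg] at h2
          exact h2
        rw [Set.indicator_of_mem (show ρ ∈ Set.Ioc 0 R from ⟨hρ, h3⟩)]
        refine le_trans ?_ le_add_self
        gcongr
        exact le_max_right _ _
    · rw [hh, Set.indicator_of_notMem (by simpa using h1)]
      simp
  have hmeas : MeasurableSet {ρ : ℝ | gaugeInv r q τ < ENNReal.ofReal ρ ∧ ρ < δ} :=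
    (measurableSet_lt measurable_const ENNReal.measurable_ofReal).inter measurableSet_Iio
  calc ∫⁻ ρ in Set.Ioi (0 : ℝ), ENNReal.ofReal ρ ^ (d - 1) * h ρ
      ≤ ∫⁻ ρ, (({ρ : ℝ | gaugeInv r q τ < ENNReal.ofReal ρ ∧ ρ < δ}.indicator
        (fun ρ => (ENNReal.ofReal (q ρ) ^ D)⁻¹ * ENNReal.ofReal ρ ^ (d - 1)) ρ) +
      (Set.Ioc 0 R).indicator
        (fun _ => (ENNReal.ofReal τ ^ D)⁻¹ * ENNReal.ofReal R ^ (d - 1)) ρ) :=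
        (setLIntegral_mono' measurableSet_Ioi hsub).trans (setLIntegral_le_lintegral _ _)
    _ = gaugeV d D r q δ τ + (gaugeG d D r q τ)⁻¹ := by
        rw [lintegral_add_right _ (measurable_const.indicator measurableSet_Ioc),
          lintegral_indicator hmeas, lintegral_indicator measurableSet_Ioc, setLIntegral_const,
          Real.volume_Ioc, sub_zero, gaugeV, inv_gaugeG h0, hRe, mul_assoc, ← pow_succ,
          Nat.sub_add_cancel (Nat.one_le_iff_ne_zero.2 (NeZero.ne d)), mul_comm (_ ^ d)]
    _ ≤ ENNReal.ofReal C * (gaugeG d D r q τ)⁻¹ + (gaugeG d D r q τ)⁻¹ :=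
        add_le_add (hCv τ h0 hT) le_rfl
    _ = ENNReal.ofReal (C + 1) * (gaugeG d D r q τ)⁻¹ := by
        rw [ENNReal.ofReal_add hC.le zero_le_one, ENNReal.ofReal_one, add_mul, one_mul]

/-! ### Gaussian densities and the two-point estimate for one component -/

theorem gaussianReal_le_of_pdf_le {m : ℝ} {v : NNReal} (hv : v ≠ 0) {s : Set ℝ}
    (hs : MeasurableSet s) {z ε κ : ℝ} (hκ : 0 ≤ κ)
    (hsub : s ⊆ Set.Ioo (z - ε) (z + ε))
    (h : ∀ w ∈ s, gaussianPDFReal m v w ≤ κ) :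
    gaussianReal m v s ≤ ENNReal.ofReal (2 * ε * κ) := by
  rw [gaussianReal_apply m hv]
  calc ∫⁻ x in s, gaussianPDF m v x ≤ ∫⁻ _ in s, ENNReal.ofReal κ :=
        setLIntegral_mono' hs fun x hx => ENNReal.ofReal_le_ofReal (h x hx)
    _ = ENNReal.ofReal κ * volume s := setLIntegral_const _ _
    _ ≤ ENNReal.ofReal κ * volume (Set.Ioo (z - ε) (z + ε)) := by gcongr
    _ = _ := by
        rw [Real.volume_Ioo, ← ENNReal.ofReal_mul hκ]
        congr 1; ring

theorem le_gaussianReal_of_le_pdf {m : ℝ} {v : NNReal} (hv : v ≠ 0) {z ε κ : ℝ} (hκ : 0 ≤ κ)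
    (h : ∀ w ∈ Set.Ioo (z - ε) (z + ε), κ ≤ gaussianPDFReal m v w) :
    ENNReal.ofReal (2 * ε * κ) ≤ gaussianReal m v (Set.Ioo (z - ε) (z + ε)) := by
  rw [gaussianReal_apply m hv]
  calc ENNReal.ofReal (2 * ε * κ) = ∫⁻ _ in Set.Ioo (z - ε) (z + ε), ENNReal.ofReal κ := by
        rw [setLIntegral_const, Real.volume_Ioo, ← ENNReal.ofReal_mul hκ]
        congr 1; ring
    _ ≤ _ := setLIntegral_mono' measurableSet_Ioo fun x hx => ENNReal.ofReal_le_ofReal (h x hx)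

theorem gaussianPDFReal_le_inv_sqrt (m : ℝ) {v : NNReal} (hv : v ≠ 0) (w : ℝ) :
    gaussianPDFReal m v w ≤ (Real.sqrt v)⁻¹ := by
  have hv' : (0 : ℝ) < v := by positivity
  rw [gaussianPDFReal]
  calc _ ≤ (Real.sqrt (2 * Real.pi * v))⁻¹ * 1 := by
        gcongr
        rw [Real.exp_le_one_iff]
        exact div_nonpos_of_nonpos_of_nonneg (by nlinarith [sq_nonneg (w - m)]) (by positivity)
    _ ≤ (Real.sqrt v)⁻¹ := by
        rw [mul_one]
        gcongr
        nlinarith [Real.two_le_pi]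

/-- From (s - 1)² ≥ 0, -s²/2 ≤ 1/2 - s; then e^(1/2) ≤ 2 and e^s ≥ s^n / n!. Only the polynomial
decay of order n = D is needed later. -/
theorem exp_neg_sq_half_le (n : ℕ) {s : ℝ} (hs : 0 < s) :
    Real.exp (-s ^ 2 / 2) ≤ 2 * n.factorial * s⁻¹ ^ n := by
  have h1 : Real.exp (-s ^ 2 / 2) ≤ Real.exp (1 / 2) * Real.exp (-s) := by
    rw [← Real.exp_add]
    exact Real.exp_le_exp.2 (by nlinarith [sq_nonneg (s - 1)])
  have h2 : Real.exp (1 / 2) ≤ 2 := by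
    have h3 : Real.exp (1 / 2) * Real.exp (1 / 2) = Real.exp 1 := by
      rw [← Real.exp_add]; norm_num
    nlinarith [Real.exp_one_lt_d9, Real.exp_pos (1 / 2 : ℝ)]
  have h4 : Real.exp (-s) ≤ n.factorial * s⁻¹ ^ n := by
    have h5 := Real.pow_div_factorial_le_exp s hs.le n
    have h6 : (0 : ℝ) < s ^ n / n.factorial := by positivity
    rw [Real.exp_neg]
    calc (Real.exp s)⁻¹ ≤ (s ^ n / n.factorial)⁻¹ := inv_anti₀ h6 h5
      _ = _ := by rw [inv_div, inv_pow, div_eq_mul_inv]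
  calc _ ≤ Real.exp (1 / 2) * Real.exp (-s) := h1
    _ ≤ 2 * (n.factorial * s⁻¹ ^ n) := by gcongr
    _ = _ := by ring

theorem gaussianPDFReal_le_of_le_abs (n : ℕ) {v : NNReal} (hv : v ≠ 0) {w u : ℝ} (hu : 0 < u)
    (huw : u ≤ |w|) :
    gaussianPDFReal 0 v w ≤ (Real.sqrt v)⁻¹ * (2 * n.factorial * (Real.sqrt v / u) ^ n) := by
  have hv' : (0 : ℝ) < v := by positivity
  have hsv : 0 < Real.sqrt v := Real.sqrt_pos.2 hv'
  rw [gaussianPDFReal]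
  gcongr
  · nlinarith [Real.two_le_pi]
  · have := exp_neg_sq_half_le n (div_pos hu hsv)
    rw [inv_div] at this
    refine le_trans (Real.exp_le_exp.2 ?_) this
    rw [div_pow, Real.sq_sqrt hv'.le, sub_zero]
    have h2 : u ^ 2 ≤ w ^ 2 := by
      rw [← sq_abs w]; gcongr
    rw [neg_div, neg_div, neg_le_neg_iff, div_div, mul_comm (v : ℝ) 2]
    gcongr

theorem le_gaussianPDFReal {m w c₁ c₂ B : ℝ} {v : NNReal} (hc₁ : 0 < c₁) (h1 : c₁ ≤ v)
    (h2 : v ≤ c₂) (hB : |w - m| ≤ B) :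
    (Real.sqrt (2 * Real.pi * c₂))⁻¹ * Real.exp (-B ^ 2 / (2 * c₁)) ≤ gaussianPDFReal m v w := by
  have hv : (0 : ℝ) < v := hc₁.trans_le h1
  have hc₂ : 0 < c₂ := hv.trans_le h2
  rw [gaussianPDFReal]
  have h3 : (w - m) ^ 2 ≤ B ^ 2 := by
    rw [← sq_abs (w - m)]; gcongr
  have h4 : -B ^ 2 / (2 * c₁) ≤ -(w - m) ^ 2 / (2 * v) := by
    rw [neg_div, neg_div, neg_le_neg_iff]
    gcongr
  gcongr

/-- Regression of one coordinate of a Gaussian vector on the other one. -/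
theorem measure_inter_le_of_hasGaussianLaw {Ω : Type*} [MeasurableSpace Ω] {P : Measure Ω}
    [IsProbabilityMeasure P] {X Y : Ω → ℝ} (hXY : HasGaussianLaw (fun ω => (X ω, Y ω)) P)
    (hY : 0 < Var[Y; P]) (hv : 0 < Var[X; P] - cov[X, Y; P] ^ 2 / Var[Y; P])
    {y z ε κ : ℝ} (hκ : 0 ≤ κ)
    (h : ∀ w u, |u - z| < ε → |w + P[X] + cov[X, Y; P] / Var[Y; P] * (u - P[Y]) - y| < ε →
      gaussianPDFReal 0 (Var[X; P] - cov[X, Y; P] ^ 2 / Var[Y; P]).toNNReal w ≤ κ) :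
    P {ω | |X ω - y| < ε ∧ |Y ω - z| < ε} ≤
      ENNReal.ofReal (2 * ε * κ) *
        gaussianReal P[Y] Var[Y; P].toNNReal (Set.Ioo (z - ε) (z + ε)) := by
  set β := cov[X, Y; P] / Var[Y; P] with hβ
  set v := Var[X; P] - cov[X, Y; P] ^ 2 / Var[Y; P] with hvdef
  have hX2 : MemLp X 2 P := hXY.fst.memLp_two
  have hY2 : MemLp Y 2 P := hXY.snd.memLp_two
  have hbY2 : MemLp (fun ω => β * Y ω) 2 P := hY2.const_mul β
  -- The centred regression residual: uncorrelated with Y, hence independent of it by joint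
  -- Gaussianity, with variance v.
  set W : Ω → ℝ := fun ω => (X ω - β * Y ω) - (P[X] - β * P[Y]) with hW
  have hWY0 : HasGaussianLaw (fun ω => (X ω - β * Y ω, Y ω)) P := by
    have := hXY.map_fun (((ContinuousLinearMap.fst ℝ ℝ ℝ) -
      β • (ContinuousLinearMap.snd ℝ ℝ ℝ)).prod (ContinuousLinearMap.snd ℝ ℝ ℝ))
    simpa using this
  have hcov : cov[fun ω => X ω - β * Y ω, Y; P] = 0 := by
    rw [covariance_fun_sub_left hX2 hbY2 hY2, covariance_const_mul_left,
      covariance_self hY2.aemeasurable, hβ, div_mul_cancel₀ _ hY.ne', sub_self]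
  have hind0 : IndepFun (fun ω => X ω - β * Y ω) Y P := hWY0.indepFun_of_covariance_eq_zero hcov
  have hsub : Measurable fun t : ℝ => t - (P[X] - β * P[Y]) := measurable_id.sub_const _
  have hind : IndepFun W Y P := hind0.comp hsub measurable_id
  have hvar0 : Var[fun ω => X ω - β * Y ω; P] = v := by
    rw [variance_fun_sub hX2 hbY2, variance_const_mul, covariance_const_mul_right, hvdef, hβ]
    field_simp
    ring
  have hmean0 : P[fun ω => X ω - β * Y ω] = P[X] - β * P[Y] := by
    rw [integral_sub (hX2.integrable (by norm_num)) (hbY2.integrable (by norm_num)),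
      integral_const_mul]
  have hWlaw : P.map W = gaussianReal 0 v.toNNReal := by
    have h1 := hWY0.fst.map_eq_gaussianReal
    rw [hmean0, hvar0] at h1
    have h2 : P.map W = (P.map (fun ω => X ω - β * Y ω)).map
        (fun t => t - (P[X] - β * P[Y])) := by
      rw [AEMeasurable.map_map_of_aemeasurable (by fun_prop) hWY0.fst.aemeasurable]
      rfl
    rw [h2, h1, gaussianReal_map_sub_const, sub_self]
  have hWm : AEMeasurable W P := hWY0.fst.aemeasurable.sub_const _
  have hYm : AEMeasurable Y P := hXY.snd.aemeasurable
  have hprod : P.map (fun ω => (W ω, Y ω)) =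
      (gaussianReal 0 v.toNNReal).prod (gaussianReal P[Y] Var[Y; P].toNNReal) := by
    rw [(indepFun_iff_map_prod_eq_prod_map_map hWm hYm).1 hind, hWlaw,
      hXY.snd.map_eq_gaussianReal]
  set S : Set (ℝ × ℝ) := {p | |p.1 + P[X] + β * (p.2 - P[Y]) - y| < ε ∧ |p.2 - z| < ε} with hS
  have hSm : MeasurableSet S := by
    exact (measurableSet_lt
      (f := fun p : ℝ × ℝ => |p.1 + P[X] + β * (p.2 - P[Y]) - y|) (g := fun _ => ε)
      (by fun_prop) (by fun_prop)).inter
      (measurableSet_lt (f := fun p : ℝ × ℝ => |p.2 - z|) (g := fun _ => ε)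
      (by fun_prop) (by fun_prop))
  have hpre : {ω | |X ω - y| < ε ∧ |Y ω - z| < ε} = (fun ω => (W ω, Y ω)) ⁻¹' S := by
    ext ω
    have : W ω + P[X] + β * (Y ω - P[Y]) - y = X ω - y := by rw [hW]; ring
    simp only [hS, Set.mem_ofPred_eq, Set.mem_preimage, this]
  have hv0 : v.toNNReal ≠ 0 := by simpa using hv
  rw [hpre, ← Measure.map_apply_of_aemeasurable (hWm.prodMk hYm) hSm, hprod,
    Measure.prod_apply_symm hSm]
  calc ∫⁻ u, gaussianReal 0 v.toNNReal ((fun w => (w, u)) ⁻¹' S)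
        ∂(gaussianReal P[Y] Var[Y; P].toNNReal)
      ≤ ∫⁻ u, (Set.Ioo (z - ε) (z + ε)).indicator (fun _ => ENNReal.ofReal (2 * ε * κ)) u
        ∂(gaussianReal P[Y] Var[Y; P].toNNReal) := by
        -- Given Y = u, the residual is confined to an interval of length 2ε, on which its density
        -- is at most κ.
        refine lintegral_mono fun u => ?_
        by_cases hu : |u - z| < ε
        · have hu' : u ∈ Set.Ioo (z - ε) (z + ε) := by
            rw [abs_lt] at hu; constructor <;> linarith
          rw [Set.indicator_of_mem hu']
          refine gaussianReal_le_of_pdf_le (z := y - P[X] - β * (u - P[Y])) hv0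
            (measurable_prodMk_right hSm) hκ ?_ ?_
          · rintro w ⟨hw, -⟩
            rw [abs_lt] at hw
            constructor <;> simp only at hw <;> linarith
          · rintro w ⟨hw, -⟩
            exact h w u hu hw
        · have : (fun w => (w, u)) ⁻¹' S = ∅ := by
            ext w; simp [hS, hu]
          simp [this]
    _ = _ := by rw [lintegral_indicator_const measurableSet_Ioo]

/-- Bounds for the residual variance `s - k² / t` and for the regression coefficient `k / t` of a
pair of square integrable random variables with variances `s`, `t` and covariance `k`. -/
theorem residual_variance_bounds {s t k a b c₁ c₂ ρ : ℝ} (ha : 0 < a) (hc₁ : 0 < c₁)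
    (hρ : 0 < ρ) (hρ1 : ρ ≤ 1) (hs : c₁ ≤ s) (ht : c₁ ≤ t) (ht2 : t ≤ c₂)
    (hlow : (a * ρ) ^ 2 ≤ s - 2 * k + t) (hup : s - 2 * k + t ≤ (b * ρ) ^ 2)
    (hbρ : (b * ρ) ^ 2 ≤ 2 * c₁) (hst : |s - t| ≤ a * √c₁ * ρ) :
    (a * √c₁ / (2 * √c₂) * ρ) ^ 2 ≤ s - k ^ 2 / t ∧ s - k ^ 2 / t ≤ (b * ρ) ^ 2 ∧
      |k / t - 1| ≤ (a * √c₁ + b ^ 2) / (2 * c₁) * ρ := by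
  have ht0 : 0 < t := hc₁.trans_le ht
  have hc₂ : 0 < c₂ := ht0.trans_le ht2
  -- In terms of e = s - 2k + t, the variance of the difference, 4t(s - k²/t) = e(2(s + t) - e) - (s
  -- - t)².
  obtain ⟨e, rfl⟩ : ∃ e, k = (s + t - e) / 2 := ⟨s + t - 2 * k, by ring⟩
  have he : s - 2 * ((s + t - e) / 2) + t = e := by ring
  rw [he] at hlow hup
  have hst2 : (s - t) ^ 2 ≤ a ^ 2 * c₁ * ρ ^ 2 := by
    rw [← sq_abs (s - t)]
    calc |s - t| ^ 2 ≤ (a * √c₁ * ρ) ^ 2 := by gcongr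
      _ = _ := by rw [mul_pow, mul_pow, Real.sq_sqrt hc₁.le]
  refine ⟨?_, ?_, ?_⟩
  · rw [mul_pow, div_pow, mul_pow, mul_pow, Real.sq_sqrt hc₁.le, Real.sq_sqrt hc₂.le]
    have h1 : a ^ 2 * c₁ * ρ ^ 2 / (4 * t) ≤ s - ((s + t - e) / 2) ^ 2 / t := by
      rw [← sub_nonneg]
      have : s - ((s + t - e) / 2) ^ 2 / t - a ^ 2 * c₁ * ρ ^ 2 / (4 * t) =
          (e * (2 * (s + t) - e) - (s - t) ^ 2 - a ^ 2 * c₁ * ρ ^ 2) / (4 * t) := by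
        field_simp; ring
      rw [this]
      apply div_nonneg _ (by positivity)
      -- Since e ≤ 2c₁ and s + t ≥ 2c₁, the second factor is at least 2c₁; half of the product
      -- absorbs (s - t)².
      have h2 : (a * ρ) ^ 2 * (2 * c₁) ≤ e * (2 * (s + t) - e) := by
        apply mul_le_mul hlow (by linarith) (by positivity)
        exact le_trans (by positivity) hlow
      nlinarith
    refine le_trans ?_ h1
    rw [show a ^ 2 * c₁ / (2 ^ 2 * c₂) * ρ ^ 2 = a ^ 2 * c₁ * ρ ^ 2 / (4 * c₂) by ring]
    gcongr
  · refine le_trans ?_ hup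
    rw [← sub_nonneg]
    have : e - (s - ((s + t - e) / 2) ^ 2 / t) = (e - (s - t)) ^ 2 / (4 * t) := by
      field_simp; ring
    rw [this]; positivity
  · have h1 : (s + t - e) / 2 / t - 1 = ((s - t) - e) / (2 * t) := by field_simp; ring
    have he0 : 0 ≤ e := le_trans (by positivity) hlow
    rw [h1, abs_div, abs_of_pos (by positivity : 0 < 2 * t), div_mul_eq_mul_div]
    have h2 : |s - t - e| ≤ (a * √c₁ + b ^ 2) * ρ := by
      have : e ≤ b ^ 2 * ρ := by
        refine hup.trans ?_
        rw [mul_pow]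
        have : ρ ^ 2 ≤ ρ := by nlinarith
        gcongr
      calc |s - t - e| ≤ |s - t| + |e| := abs_sub _ _
        _ ≤ a * √c₁ * ρ + b ^ 2 * ρ := by rw [abs_of_nonneg he0]; gcongr
        _ = _ := by ring
    gcongr

-- The first bound ignores X; the second uses the maximal residual density, of order 1/ρ; the third
-- uses its tail. The tail exponent is D because one coordinate will have to supply the decay for
-- all D of them.
set_option maxHeartbeats 1000000 in
theorem exists_measure_inter_le.{u} (D : ℕ) {a b c₁ c₂ L B : ℝ} (ha : 0 < a) (hb : 0 < b)
    (hc₁ : 0 < c₁) (hc₂ : 0 < c₂) (hL : 0 < L) (hB : 0 ≤ B) :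
    ∃ C : ℝ, 1 ≤ C ∧ ∀ {Ω : Type u} [MeasurableSpace Ω] {P : Measure Ω} [IsProbabilityMeasure P]
      {X Y : Ω → ℝ} {ρ ε y z : ℝ}, HasGaussianLaw (fun ω => (X ω, Y ω)) P →
      0 < ρ → ρ ≤ 1 → (b * ρ) ^ 2 ≤ 2 * c₁ → c₁ ≤ Var[X; P] → c₁ ≤ Var[Y; P] → Var[Y; P] ≤ c₂ →
      |Var[X; P] - Var[Y; P]| ≤ a * √c₁ * ρ →
      (a * ρ) ^ 2 ≤ Var[fun ω => X ω - Y ω; P] → Var[fun ω => X ω - Y ω; P] ≤ (b * ρ) ^ 2 →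
      |P[X] - P[Y]| ≤ L * ρ → |z - P[Y]| ≤ B → 0 < ε → ε ≤ 1 →
      P {ω | |X ω - y| < ε ∧ |Y ω - z| < ε} ≤ ENNReal.ofReal (C * ε) ∧
      P {ω | |X ω - y| < ε ∧ |Y ω - z| < ε} ≤ ENNReal.ofReal (C * ε ^ 2 / ρ) ∧
      (4 * ε ≤ |y - z| → P {ω | |X ω - y| < ε ∧ |Y ω - z| < ε} ≤
        ENNReal.ofReal (C * ε ^ 2 / ρ * (ρ / |y - z|) ^ D)) := by
  set α : ℝ := a * √c₁ / (2 * √c₂) with hα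
  have hα0 : 0 < α := by positivity
  set C₁ : ℝ := (a * √c₁ + b ^ 2) / (2 * c₁) with hC₁
  have hC₁0 : 0 < C₁ := by positivity
  set C₂ : ℝ := L + C₁ * (B + 1) with hC₂
  have hC₂0 : 0 < C₂ := by positivity
  set J : ℝ := 1 + 2 * D.factorial * (4 * b) ^ D + (4 * C₂) ^ D with hJ
  have hJ1 : 1 ≤ J := by
    have : 0 ≤ 2 * D.factorial * (4 * b) ^ D + (4 * C₂) ^ D := by positivity
    linarith
  set C : ℝ := 1 + 2 * (√c₁)⁻¹ + 4 * (√c₁)⁻¹ * α⁻¹ * J with hC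
  have hs0 : 0 < (√c₁)⁻¹ := by positivity
  have hC1 : 1 ≤ C := by
    have : 0 ≤ 2 * (√c₁)⁻¹ + 4 * (√c₁)⁻¹ * α⁻¹ * J := by positivity
    linarith
  refine ⟨C, hC1, ?_⟩
  intro Ω _ P _ X Y ρ ε y z hXY hρ hρ1 hbρ hXc hYc hYc2 hst hlow hup hm hz hε hε1
  have hX2 : MemLp X 2 P := hXY.fst.memLp_two
  have hY2 : MemLp Y 2 P := hXY.snd.memLp_two
  have hY0 : 0 < Var[Y; P] := hc₁.trans_le hYc
  rw [variance_fun_sub hX2 hY2] at hlow hup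
  obtain ⟨hv1, hv2, hβ⟩ := residual_variance_bounds ha hc₁ hρ hρ1 hXc hYc hYc2 hlow hup hbρ hst
  set v := Var[X; P] - cov[X, Y; P] ^ 2 / Var[Y; P] with hv
  set β := cov[X, Y; P] / Var[Y; P] with hβdef
  have hv0 : 0 < v := lt_of_lt_of_le (by positivity) hv1
  have hvc : ((v.toNNReal : NNReal) : ℝ) = v := Real.coe_toNNReal _ hv0.le
  have hvn : v.toNNReal ≠ 0 := by simpa using hv0
  have hsv : (√v)⁻¹ ≤ α⁻¹ * ρ⁻¹ := by
    rw [← mul_inv]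
    exact inv_anti₀ (by positivity) (Real.le_sqrt_of_sq_le hv1)
  have hsv2 : √v ≤ b * ρ := (Real.sqrt_le_left (by positivity)).2 hv2
  have hYle : gaussianReal P[Y] Var[Y; P].toNNReal (Set.Ioo (z - ε) (z + ε)) ≤
      ENNReal.ofReal (2 * ε * (√c₁)⁻¹) := by
    refine gaussianReal_le_of_pdf_le (z := z) (by simpa using hY0) measurableSet_Ioo hs0.le
      subset_rfl fun w _ => ?_
    refine (gaussianPDFReal_le_inv_sqrt _ (by simpa using hY0) w).trans ?_
    rw [Real.coe_toNNReal _ hY0.le]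
    gcongr
  have main : ∀ κ : ℝ, 0 ≤ κ → (∀ w u, |u - z| < ε →
      |w + P[X] + β * (u - P[Y]) - y| < ε → gaussianPDFReal 0 v.toNNReal w ≤ κ) →
      P {ω | |X ω - y| < ε ∧ |Y ω - z| < ε} ≤
        ENNReal.ofReal (4 * (√c₁)⁻¹ * ε ^ 2 * κ) := by
    intro κ hκ h
    refine (measure_inter_le_of_hasGaussianLaw hXY hY0 hv0 hκ h).trans ?_
    refine (mul_le_mul_right hYle _).trans ?_
    rw [← ENNReal.ofReal_mul (by positivity)]
    exact ENNReal.ofReal_le_ofReal (by nlinarith)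
  have pdf1 : ∀ w, gaussianPDFReal 0 v.toNNReal w ≤ α⁻¹ * ρ⁻¹ := fun w => by
    refine (gaussianPDFReal_le_inv_sqrt _ hvn w).trans ?_
    rwa [hvc]
  refine ⟨?_, ?_, ?_⟩
  · have hsub : {ω | |X ω - y| < ε ∧ |Y ω - z| < ε} ⊆ Y ⁻¹' (Set.Ioo (z - ε) (z + ε)) := by
      rintro ω ⟨-, h⟩
      rw [abs_lt] at h
      constructor <;> linarith
    refine (measure_mono hsub).trans ?_
    rw [← Measure.map_apply_of_aemeasurable hXY.snd.aemeasurable measurableSet_Ioo,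
      hXY.snd.map_eq_gaussianReal]
    refine hYle.trans (ENNReal.ofReal_le_ofReal ?_)
    have : 2 * (√c₁)⁻¹ ≤ C := by
      have : 0 ≤ 4 * (√c₁)⁻¹ * α⁻¹ * J := by positivity
      linarith
    nlinarith
  · refine (main (α⁻¹ * ρ⁻¹) (by positivity) fun w u _ _ => pdf1 w).trans
      (ENNReal.ofReal_le_ofReal ?_)
    have h1 : 4 * (√c₁)⁻¹ * α⁻¹ ≤ C := by
      have : 4 * (√c₁)⁻¹ * α⁻¹ * 1 ≤ 4 * (√c₁)⁻¹ * α⁻¹ * J := by gcongr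
      linarith
    calc 4 * (√c₁)⁻¹ * ε ^ 2 * (α⁻¹ * ρ⁻¹) = 4 * (√c₁)⁻¹ * α⁻¹ * ε ^ 2 / ρ := by
          rw [div_eq_mul_inv]; ring
      _ ≤ _ := by gcongr
  · intro ht
    set t := |y - z| with htdef
    have ht0 : 0 < t := by linarith
    have hJle : ∀ x : ℝ, 0 ≤ x → x ≤ J → α⁻¹ * ρ⁻¹ * (x * (ρ / t) ^ D) ≤
        α⁻¹ * ρ⁻¹ * (J * (ρ / t) ^ D) := fun x _ hx => by gcongr
    have hp1 : 0 ≤ 2 * D.factorial * (4 * b) ^ D := by positivity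
    have hp2 : 0 ≤ (4 * C₂) ^ D := by positivity
    refine (main (α⁻¹ * ρ⁻¹ * (J * (ρ / t) ^ D)) (by positivity) fun w u hu hw => ?_).trans
      (ENNReal.ofReal_le_ofReal ?_)
    -- C₂ρ bounds the mean increment plus the effect of β ≠ 1. If it is at most t/4, the two windows
    -- use at most t/2 more, so |w| ≥ t/4 and the tail bound applies. Otherwise (4C₂ρ/t)^D ≥ 1 and
    -- the maximal density suffices.
    · rcases le_or_gt (C₂ * ρ) (t / 4) with hcase | hcase
      · have huY : |u - P[Y]| ≤ B + 1 := by
          calc |u - P[Y]| = |(u - z) + (z - P[Y])| := by ring_nf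
            _ ≤ |u - z| + |z - P[Y]| := abs_add_le _ _
            _ ≤ B + 1 := by linarith
        have hwt : t / 4 ≤ |w| := by
          have h1 : y - z = w + (P[X] - P[Y]) + (β - 1) * (u - P[Y]) + (u - z) -
              (w + P[X] + β * (u - P[Y]) - y) := by ring
          have h2 : t ≤ |w| + L * ρ + C₁ * ρ * (B + 1) + ε + ε := by
            rw [htdef, h1]
            refine (abs_sub _ _).trans (add_le_add ?_ hw.le)
            refine (abs_add_le _ _).trans (add_le_add ?_ hu.le)
            refine (abs_add_le _ _).trans (add_le_add ?_ ?_)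
            · exact (abs_add_le _ _).trans (add_le_add le_rfl hm)
            · rw [abs_mul]
              gcongr
          have h3 : C₂ * ρ = L * ρ + C₁ * ρ * (B + 1) := by rw [hC₂]; ring
          linarith
        refine (gaussianPDFReal_le_of_le_abs D hvn (by positivity) hwt).trans ?_
        rw [hvc]
        refine le_trans ?_ (hJle (2 * D.factorial * (4 * b) ^ D) hp1 (by linarith))
        calc (√v)⁻¹ * (2 * D.factorial * (√v / (t / 4)) ^ D)
            ≤ α⁻¹ * ρ⁻¹ * (2 * D.factorial * (b * ρ / (t / 4)) ^ D) := by gcongr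
          _ = _ := by
            rw [show b * ρ / (t / 4) = 4 * b * (ρ / t) by ring, mul_pow]
            ring
      · refine (pdf1 w).trans (le_trans ?_ (hJle ((4 * C₂) ^ D) hp2 (by linarith)))
        refine le_mul_of_one_le_right (by positivity) ?_
        rw [← mul_pow]
        apply one_le_pow₀
        rw [← mul_div_assoc, one_le_div ht0]
        linarith
    · have h1 : 4 * (√c₁)⁻¹ * α⁻¹ * J ≤ C := by linarith
      calc 4 * (√c₁)⁻¹ * ε ^ 2 * (α⁻¹ * ρ⁻¹ * (J * (ρ / t) ^ D))
          = 4 * (√c₁)⁻¹ * α⁻¹ * J * ε ^ 2 / ρ * (ρ / t) ^ D := by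
            rw [div_eq_mul_inv]; ring
        _ ≤ _ := by gcongr

/-! ### From one component to D independent components -/

theorem l2Norm_sub_integral_sq {Ω : Type*} [MeasurableSpace Ω] (P : Measure Ω) (Z : Ω → ℝ) :
    l2Norm P (fun ω => Z ω - P[Z]) ^ 2 = Var[Z; P] := by
  rw [l2Norm, variance, evariance, ← ENNReal.toReal_pow]
  congr 1
  have := eLpNorm_nnreal_pow_eq_lintegral (μ := P) (p := 2) (f := fun ω => Z ω - P[Z]) (by simp)
  simpa using this

theorem l2Norm_const {Ω : Type*} [MeasurableSpace Ω] (P : Measure Ω)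
    [IsProbabilityMeasure P] (c : ℝ) : l2Norm P (fun _ => c) = |c| := by
  rw [l2Norm, eLpNorm_const c (by simp) (IsProbabilityMeasure.ne_zero P)]
  simp

theorem l2Norm_add_le {Ω : Type*} [MeasurableSpace Ω] {P : Measure Ω} {X Y : Ω → ℝ}
    (hX : MemLp X 2 P) (hY : MemLp Y 2 P) :
    l2Norm P (fun ω => X ω + Y ω) ≤ l2Norm P X + l2Norm P Y := by
  rw [l2Norm, l2Norm, l2Norm, ← ENNReal.toReal_add hX.eLpNorm_ne_top hY.eLpNorm_ne_top]
  exact ENNReal.toReal_mono (ENNReal.add_ne_top.2 ⟨hX.eLpNorm_ne_top, hY.eLpNorm_ne_top⟩)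
    (eLpNorm_add_le hX.1 hY.1 (by norm_num))

theorem euclidean_norm_le_card_mul {D : ℕ} {w : EuclideanSpace ℝ (Fin D)} {m : ℝ}
    (h : ∀ i, |w i| ≤ m) (hm : 0 ≤ m) : ‖w‖ ≤ D * m := by
  rw [EuclideanSpace.norm_eq, Real.sqrt_le_left (by positivity)]
  calc ∑ i, ‖w i‖ ^ 2 ≤ ∑ _i : Fin D, m ^ 2 := by
        gcongr with i
        exact h i
    _ = D * m ^ 2 := by simp
    _ ≤ (D * m) ^ 2 := by
        rw [mul_pow]
        gcongr
        exact_mod_cast Nat.le_self_pow two_ne_zero D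

/-- If ‖w‖ > ρ, the largest coordinate satisfies |w_i| ≥ ‖w‖/D. When |w_i| ≥ 4ε, its factor
(ρ/|w_i|)^D turns all D factors 1/ρ into 1/|w_i|. When |w_i| < 4ε, ε ≤ 4Dε²/‖w‖ and the first bound
is enough. -/
theorem prod_le_of_pairwise_bounds {D : ℕ} [NeZero D] {C ε ρ : ℝ} (hC : 1 ≤ C) (hε : 0 < ε)
    (hρ : 0 < ρ) (w : EuclideanSpace ℝ (Fin D)) (p : Fin D → ℝ≥0∞)
    (h1 : ∀ i, p i ≤ ENNReal.ofReal (C * ε)) (h2 : ∀ i, p i ≤ ENNReal.ofReal (C * ε ^ 2 / ρ))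
    (h3 : ∀ i, 4 * ε ≤ |w i| → p i ≤ ENNReal.ofReal (C * ε ^ 2 / ρ * (ρ / |w i|) ^ D)) :
    ∏ i, p i ≤ ENNReal.ofReal ((4 * D * C * ε ^ 2 / max ρ ‖w‖) ^ D) := by
  have hD : (1 : ℝ) ≤ D := by exact_mod_cast Nat.one_le_iff_ne_zero.2 (NeZero.ne D)
  rcases max_cases ρ ‖w‖ with ⟨hmax, -⟩ | ⟨hmax, hlt⟩
  · rw [hmax]
    refine (Finset.prod_le_prod' fun i _ => h2 i).trans ?_
    rw [Finset.prod_const, Finset.card_univ, Fintype.card_fin, ← ENNReal.ofReal_pow (by positivity)]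
    apply ENNReal.ofReal_le_ofReal
    gcongr
    nlinarith
  · rw [hmax]
    have hw0 : 0 < ‖w‖ := hρ.trans hlt
    obtain ⟨i, -, hi⟩ := Finset.exists_max_image Finset.univ (fun i => |w i|)
      Finset.univ_nonempty
    have hwi : ‖w‖ ≤ D * |w i| :=
      euclidean_norm_le_card_mul (fun j => hi j (Finset.mem_univ j)) (abs_nonneg _)
    have hm : 0 < |w i| := by
      by_contra hcon
      have : |w i| = 0 := le_antisymm (not_lt.1 hcon) (abs_nonneg _)
      rw [this, mul_zero] at hwi
      linarith
    rcases le_or_gt (4 * ε) |w i| with hc | hc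
    · have hb : ∀ j, p j ≤ ENNReal.ofReal (C * ε ^ 2 / ρ * if j = i then (ρ / |w i|) ^ D else 1) := by
        intro j
        split_ifs with hji
        · subst hji; exact h3 j hc
        · rw [mul_one]; exact h2 j
      refine (Finset.prod_le_prod' fun j _ => hb j).trans ?_
      rw [← ENNReal.ofReal_prod_of_nonneg fun j _ => by split_ifs <;> positivity]
      apply ENNReal.ofReal_le_ofReal
      rw [Finset.prod_mul_distrib, Finset.prod_const, Finset.card_univ, Fintype.card_fin,
        Finset.prod_ite_eq' Finset.univ i, if_pos (Finset.mem_univ i), ← mul_pow]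
      gcongr
      rw [div_mul_div_comm, mul_comm ρ |w i|, mul_div_mul_right _ _ hρ.ne', div_le_div_iff₀ hm hw0]
      calc C * ε ^ 2 * ‖w‖ ≤ C * ε ^ 2 * (D * |w i|) := by gcongr
        _ ≤ 4 * (C * ε ^ 2 * (D * |w i|)) := by
            have : 0 ≤ C * ε ^ 2 * (D * |w i|) := by positivity
            linarith
        _ = _ := by ring
    · refine (Finset.prod_le_prod' fun i _ => h1 i).trans ?_
      rw [Finset.prod_const, Finset.card_univ, Fintype.card_fin,
        ← ENNReal.ofReal_pow (by positivity)]
      apply ENNReal.ofReal_le_ofReal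
      gcongr
      rw [le_div_iff₀ hw0]
      calc C * ε * ‖w‖ ≤ C * ε * (D * (4 * ε)) := by
            gcongr
            exact hwi.trans (by gcongr)
        _ = _ := by ring

section Field

variable {d D : ℕ} {Ω : Type*} [MeasurableSpace Ω] {P : Measure Ω}
  {M : EuclideanSpace ℝ (Fin d) → Ω → EuclideanSpace ℝ (Fin D)}

theorem IIDComponents.measure_forall_eq_prod [NeZero D] (h : IIDComponents P M)
    (S : Fin D → Set (EuclideanSpace ℝ (Fin d) → ℝ)) (hS : ∀ i, MeasurableSet (S i)) :
    P {ω | ∀ i, (fun x => M x ω i) ∈ S i} = ∏ i, P {ω | (fun x => M x ω 0) ∈ S i} := by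
  have h1 := h.indep.measure_inter_preimage_eq_mul Finset.univ (sets := S) fun i _ => hS i
  have h2 : {ω | ∀ i, (fun x => M x ω i) ∈ S i} =
      ⋂ i ∈ Finset.univ, (fun (ω : Ω) (x : EuclideanSpace ℝ (Fin d)) => M x ω i) ⁻¹' S i := by
    ext ω; simp
  rw [h2, h1]
  exact Finset.prod_congr rfl fun i _ => (h.identDistrib i 0).measure_mem_eq (hS i)

theorem meanFn_apply (hM : IsGaussianProcess M P) (x : EuclideanSpace ℝ (Fin d)) (i : Fin D) :
    meanFn P M x i = ∫ ω, M x ω i ∂P := by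
  have hint : Integrable (M x) P := (hM.hasGaussianLaw_eval x).integrable
  exact ((EuclideanSpace.proj (𝕜 := ℝ) i).integral_comp_comm hint).symm

theorem hasGaussianLaw_comp₁_prodMk [NeZero D] (hM : IsGaussianProcess M P)
    (x z : EuclideanSpace ℝ (Fin d)) :
    HasGaussianLaw (fun ω => (comp₁ M x ω, comp₁ M z ω)) P := by
  have h := hM.hasGaussianLaw_prodMk (s := x) (t := z)
  exact h.map_fun ((EuclideanSpace.proj (𝕜 := ℝ) (0 : Fin D)).prodMap
    (EuclideanSpace.proj (𝕜 := ℝ) (0 : Fin D)))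

/-- Identical distribution moves every coordinate to the first component, hence the mean `meanFn P M
x 0` for all i. A window of half-width ε ≤ 1 stays within B + 1 of it. -/
theorem le_measure_forall_abs_sub_lt [IsProbabilityMeasure P] [NeZero D] (hM : IsGaussianProcess M P)
    (hI : IIDComponents P M) {x : EuclideanSpace ℝ (Fin d)} {c₁ c₂ B ε : ℝ} (hc₁ : 0 < c₁)
    (h1 : c₁ ≤ Var[comp₁ M x; P]) (h2 : Var[comp₁ M x; P] ≤ c₂) (hε1 : ε ≤ 1)
    {y : EuclideanSpace ℝ (Fin D)} (hB : ∀ i, |y i - meanFn P M x 0| ≤ B) :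
    ENNReal.ofReal (2 * ε * ((√(2 * Real.pi * c₂))⁻¹ * Real.exp (-(B + 1) ^ 2 / (2 * c₁)))) ^ D ≤
      P {ω | ∀ i, |M x ω i - y i| < ε} := by
  have hv : 0 < Var[comp₁ M x; P] := hc₁.trans_le h1
  have h := hI.measure_forall_eq_prod
    (fun i => (fun φ : EuclideanSpace ℝ (Fin d) → ℝ => φ x) ⁻¹' Set.Ioo (y i - ε) (y i + ε))
    (fun i => measurable_pi_apply x measurableSet_Ioo)
  have hset : {ω | ∀ i, |M x ω i - y i| < ε} = {ω | ∀ i, (fun x => M x ω i) ∈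
      (fun φ : EuclideanSpace ℝ (Fin d) → ℝ => φ x) ⁻¹' Set.Ioo (y i - ε) (y i + ε)} := by
    ext ω
    refine forall_congr' fun i => ?_
    simp only [Set.mem_preimage, Set.mem_Ioo, abs_lt]
    constructor <;> rintro ⟨_, _⟩ <;> constructor <;> linarith
  rw [hset, h]
  have hcard : ∀ t : ℝ≥0∞, t ^ D = ∏ _i : Fin D, t := fun t => by simp
  rw [hcard]
  refine Finset.prod_le_prod' fun i _ => ?_
  have hg : HasGaussianLaw (comp₁ M x) P := (hasGaussianLaw_comp₁_prodMk hM x x).fst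
  have hpre : {ω | (fun x => M x ω 0) ∈
      (fun φ : EuclideanSpace ℝ (Fin d) → ℝ => φ x) ⁻¹' Set.Ioo (y i - ε) (y i + ε)} =
      comp₁ M x ⁻¹' Set.Ioo (y i - ε) (y i + ε) := rfl
  rw [hpre, ← Measure.map_apply_of_aemeasurable hg.aemeasurable measurableSet_Ioo,
    hg.map_eq_gaussianReal]
  refine le_gaussianReal_of_le_pdf (by simpa using hv) (by positivity) fun w hw => ?_
  refine le_gaussianPDFReal hc₁ ?_ ?_ ?_
  · rwa [Real.coe_toNNReal _ hv.le]
  · rwa [Real.coe_toNNReal _ hv.le]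
  · have h3 := hB i
    rw [meanFn_apply hM] at h3
    have h4 : |w - y i| ≤ 1 := by
      rw [abs_le]; constructor <;> linarith [hw.1, hw.2]
    calc |w - ∫ ω, comp₁ M x ω ∂P| = |(w - y i) + (y i - ∫ ω, M x ω 0 ∂P)| := by
          rw [sub_add_sub_cancel]; rfl
      _ ≤ |w - y i| + |y i - ∫ ω, M x ω 0 ∂P| := abs_add_le _ _
      _ ≤ B + 1 := by linarith

end Field

theorem exists_measure_forall_abs_sub_lt_le.{u} {d D : ℕ} [NeZero D] {q : ℝ → ℝ}
    {c₁ c₂ c₃ η a b L B : ℝ}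
    (hc₁ : 0 < c₁) (hc₂ : 0 < c₂) (hc₃ : 0 < c₃) (hη : 0 < η) (ha : 0 < a) (hb : 0 < b)
    (hL : 0 < L) (hB : 0 ≤ B) :
    ∃ C : ℝ, 0 < C ∧ ∀ (K : Set (EuclideanSpace ℝ (Fin d)))
      {Ω : Type u} [MeasurableSpace Ω] {P : Measure Ω} [IsProbabilityMeasure P]
      {M : EuclideanSpace ℝ (Fin d) → Ω → EuclideanSpace ℝ (Fin D)},
      IsGaussianProcess M P → IIDComponents P M → HypHM P M K q c₁ c₂ c₃ η a b L →
      ∀ x ∈ K, ∀ x' ∈ K, 0 < q (dist x x') → q (dist x x') ≤ 1 →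
      (b * q (dist x x')) ^ 2 ≤ 2 * c₁ →
      c₃ * ((b + L) * q (dist x x')) ^ (1 + η) ≤ a * √c₁ * q (dist x x') →
      ∀ (y z : EuclideanSpace ℝ (Fin D)) (ε : ℝ), (∀ i, |z i - meanFn P M x' 0| ≤ B) →
      0 < ε → ε ≤ 1 →
      P {ω | ∀ i, |M x ω i - y i| < ε ∧ |M x' ω i - z i| < ε} ≤
        ENNReal.ofReal ((C * ε ^ 2 / max (q (dist x x')) ‖y - z‖) ^ D) := by
  obtain ⟨C, hC, h⟩ := exists_measure_inter_le.{u} D ha hb hc₁ hc₂ hL hB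
  have hD : (0 : ℝ) < D := by exact_mod_cast Nat.pos_of_ne_zero (NeZero.ne D)
  refine ⟨4 * D * C, by positivity, ?_⟩
  intro K Ω _ P _ M hM hI hH x hx x' hx' hρ hρ1 hρb hρc y z ε hz hε hε1
  set ρ := q (dist x x') with hρdef
  have hg := hasGaussianLaw_comp₁_prodMk hM x x'
  have hX2 : MemLp (comp₁ M x) 2 P := hg.fst.memLp_two
  have hY2 : MemLp (comp₁ M x') 2 P := hg.snd.memLp_two
  have hvar : l2Norm P (fun ω => centredComp₁ P M x ω - centredComp₁ P M x' ω) ^ 2 =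
      Var[fun ω => comp₁ M x ω - comp₁ M x' ω; P] := by
    rw [← l2Norm_sub_integral_sq,
      integral_sub (hX2.integrable (by norm_num)) (hY2.integrable (by norm_num))]
    congr 2
    ext ω
    simp only [centredComp₁, meanFn_apply hM, comp₁]
    ring
  have hlow := hH.metric_lower x hx x' hx'
  have hup := hH.metric_upper x hx x' hx'
  rw [← hρdef] at hlow hup
  have hmean : |meanFn P M x 0 - meanFn P M x' 0| ≤ L * ρ := by
    refine le_trans ?_ (hH.mean_sub x hx x' hx')
    rw [dist_eq_norm]
    exact PiLp.norm_apply_le (meanFn P M x - meanFn P M x') 0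
  -- The variance regularity involves the uncentred increment, so the mean contributes L next to b.
  have hl2 : l2Norm P (fun ω => comp₁ M x ω - comp₁ M x' ω) ≤ (b + L) * ρ := by
    have hc : MemLp (fun ω => centredComp₁ P M x ω - centredComp₁ P M x' ω) 2 P :=
      (hX2.sub (memLp_const _)).sub (hY2.sub (memLp_const _))
    have hk : MemLp (fun _ : Ω => meanFn P M x 0 - meanFn P M x' 0) 2 P := memLp_const _
    have := l2Norm_add_le hc hk
    rw [l2Norm_const] at this
    have heq : (fun ω => centredComp₁ P M x ω - centredComp₁ P M x' ω +
        (meanFn P M x 0 - meanFn P M x' 0)) = fun ω => comp₁ M x ω - comp₁ M x' ω := by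
      ext ω
      simp only [centredComp₁, comp₁]
      ring
    rw [heq] at this
    linarith
  have hl0 : 0 ≤ l2Norm P (fun ω => comp₁ M x ω - comp₁ M x' ω) := ENNReal.toReal_nonneg
  have key := fun i : Fin D => h (y := y i) (z := z i) (ε := ε) hg hρ hρ1 hρb
    (hH.var_bounds x hx).1 (hH.var_bounds x' hx').1 (hH.var_bounds x' hx').2
    ((hH.var_sub x hx x' hx').trans (le_trans (by gcongr) hρc))
    (by rw [← hvar]; gcongr)
    (by rw [← hvar]; gcongr; exact ENNReal.toReal_nonneg)
    (by rw [meanFn_apply hM, meanFn_apply hM] at hmean; exact hmean)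
    (by have h1 := hz i; rw [meanFn_apply hM] at h1; exact h1) hε hε1
  have hS : ∀ i, MeasurableSet {φ : EuclideanSpace ℝ (Fin d) → ℝ |
      |φ x - y i| < ε ∧ |φ x' - z i| < ε} := fun i =>
    (measurableSet_lt (f := fun φ : EuclideanSpace ℝ (Fin d) → ℝ => |φ x - y i|) (g := fun _ => ε)
      (by fun_prop) (by fun_prop)).inter
    (measurableSet_lt (f := fun φ : EuclideanSpace ℝ (Fin d) → ℝ => |φ x' - z i|) (g := fun _ => ε)
      (by fun_prop) (by fun_prop))
  have hprod := hI.measure_forall_eq_prod _ hS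
  have hset : {ω | ∀ i, |M x ω i - y i| < ε ∧ |M x' ω i - z i| < ε} =
      {ω | ∀ i, (fun x => M x ω i) ∈ {φ : EuclideanSpace ℝ (Fin d) → ℝ |
        |φ x - y i| < ε ∧ |φ x' - z i| < ε}} := rfl
  rw [hset, hprod]
  exact prod_le_of_pairwise_bounds hC hε hρ (y - z) _ (fun i => (key i).1) (fun i => (key i).2.1)
    (fun i => (key i).2.2)

/-! ### The second moment method -/

/-- Cauchy–Schwarz for J times the indicator of {J ≠ 0}. -/
theorem sq_lintegral_le {Ω : Type*} [MeasurableSpace Ω] {P : Measure Ω} {J : Ω → ℝ≥0∞}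
    (hJ : Measurable J) : (∫⁻ ω, J ω ∂P) ^ 2 ≤ (∫⁻ ω, J ω ^ 2 ∂P) * P {ω | J ω ≠ 0} := by
  have hH : MeasurableSet {ω | J ω ≠ 0} := (hJ (measurableSet_singleton 0)).compl
  have h1 := ENNReal.lintegral_mul_le_Lp_mul_Lq P Real.HolderConjugate.two_two hJ.aemeasurable
    ((measurable_const (a := (1 : ℝ≥0∞))).indicator hH).aemeasurable
  have h2 : ∀ ω, (J * {ω | J ω ≠ 0}.indicator fun _ => (1 : ℝ≥0∞)) ω = J ω := by
    intro ω
    by_cases h : J ω = 0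
    · simp [h]
    · simp [h]
  have h3 : ∀ ω, ({ω | J ω ≠ 0}.indicator (fun _ => (1 : ℝ≥0∞)) ω) ^ (2 : ℝ) =
      {ω | J ω ≠ 0}.indicator (fun _ => (1 : ℝ≥0∞)) ω := by
    intro ω
    by_cases h : J ω = 0
    · simp [h]
    · simp [h]
  simp_rw [h2, h3] at h1
  rw [lintegral_indicator_const hH, one_mul] at h1
  have h4 : ∀ t : ℝ≥0∞, (t ^ (1 / 2 : ℝ)) ^ 2 = t := by
    intro t
    rw [← ENNReal.rpow_natCast, ← ENNReal.rpow_mul]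
    norm_num
  calc (∫⁻ ω, J ω ∂P) ^ 2 ≤ _ := pow_le_pow_left' h1 2
    _ = _ := by
      rw [mul_pow, h4, h4]
      simp

/-- The second moment method for a random measurable subset of a measure space. -/
theorem exists_measurableSet_of_second_moment {T Ω : Type*} [MeasurableSpace T]
    [MeasurableSpace Ω] {ν : Measure T} [SFinite ν] {P : Measure Ω} [SFinite P] {B : Set (T × Ω)}
    (hB : MeasurableSet B) {α β : ℝ≥0∞} (h1 : ∀ᵐ t ∂ν, α ≤ P {ω | (t, ω) ∈ B})
    (h2 : ∫⁻ p, P {ω | (p.1, ω) ∈ B ∧ (p.2, ω) ∈ B} ∂(ν.prod ν) ≤ β) :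
    ∃ H, MeasurableSet H ∧ (∀ ω ∈ H, ∃ t, (t, ω) ∈ B) ∧ (α * ν Set.univ) ^ 2 ≤ β * P H := by
  set J : Ω → ℝ≥0∞ := fun ω => ν ((fun t => (t, ω)) ⁻¹' B) with hJ
  have hJm : Measurable J := measurable_measure_prodMk_right hB
  refine ⟨{ω | J ω ≠ 0}, (hJm (measurableSet_singleton 0)).compl, fun ω hω => ?_, ?_⟩
  · obtain ⟨t, ht⟩ := nonempty_of_measure_ne_zero hω
    exact ⟨t, ht⟩
  have hE1 : α * ν Set.univ ≤ ∫⁻ ω, J ω ∂P := by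
    rw [hJ, ← Measure.prod_apply_symm hB, Measure.prod_apply hB, ← lintegral_const]
    exact lintegral_mono_ae h1
  set B₂ : Set ((T × T) × Ω) := {p | (p.1.1, p.2) ∈ B ∧ (p.1.2, p.2) ∈ B} with hB₂
  have hB₂m : MeasurableSet B₂ := by
    have e1 : Measurable fun p : (T × T) × Ω => (p.1.1, p.2) := by fun_prop
    have e2 : Measurable fun p : (T × T) × Ω => (p.1.2, p.2) := by fun_prop
    exact (e1 hB).inter (e2 hB)
  have hE2 : ∫⁻ ω, J ω ^ 2 ∂P ≤ β := by
    refine le_trans (le_of_eq ?_) h2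
    calc ∫⁻ ω, J ω ^ 2 ∂P = ∫⁻ ω, (ν.prod ν) ((fun p => (p, ω)) ⁻¹' B₂) ∂P := by
          refine lintegral_congr fun ω => ?_
          have : (fun p => (p, ω)) ⁻¹' B₂ =
            ((fun t => (t, ω)) ⁻¹' B) ×ˢ ((fun t => (t, ω)) ⁻¹' B) := rfl
          rw [this, Measure.prod_prod, sq]
      _ = _ := by
          rw [← Measure.prod_apply_symm hB₂m, Measure.prod_apply hB₂m]
          rfl
  calc _ ≤ (∫⁻ ω, J ω ∂P) ^ 2 := pow_le_pow_left' hE1 2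
    _ ≤ _ := sq_lintegral_le hJm
    _ ≤ _ := by gcongr

/-! ### Passage to the limit in ε and the hitting probability -/

theorem le_measure_limsup {Ω : Type*} [MeasurableSpace Ω] {P : Measure Ω} [IsFiniteMeasure P]
    {H : ℕ → Set Ω} (hH : ∀ n, MeasurableSet (H n)) {p : ℝ≥0∞} (hp : ∀ n, p ≤ P (H n)) :
    p ≤ P (⋂ n, ⋃ k ≥ n, H k) := by
  have hanti : Antitone fun n => ⋃ k ≥ n, H k := fun m n hmn =>
    Set.iUnion₂_subset fun k hk => Set.subset_iUnion₂_of_subset k (le_trans hmn hk) subset_rfl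
  have ht := tendsto_measure_iInter_atTop (μ := P)
    (fun n => (MeasurableSet.iUnion fun k => MeasurableSet.iUnion fun _ => hH k).nullMeasurableSet)
    hanti ⟨0, measure_ne_top _ _⟩
  exact ge_of_tendsto' ht fun n => (hp n).trans
    (measure_mono (Set.subset_iUnion₂_of_subset n le_rfl subset_rfl))

section Field

variable {d D : ℕ} {Ω : Type*} [MeasurableSpace Ω] {P : Measure Ω}
  {M : EuclideanSpace ℝ (Fin d) → Ω → EuclideanSpace ℝ (Fin D)}

/-- On the upper limit of the H_n, the continuous function ‖M(x) - y‖ attains its minimum on the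
compact K × A, and this minimum is at most D/(n + 1) for every n. -/
theorem le_measure_image_inter_nonempty [IsFiniteMeasure P] {K : Set (EuclideanSpace ℝ (Fin d))} (hK : IsCompact K)
    {A : Set (EuclideanSpace ℝ (Fin D))} (hA : IsCompact A)
    (hcont : ∀ᵐ ω ∂P, ContinuousOn (fun x => M x ω) K)
    {H : ℕ → Set Ω} (hH : ∀ n, MeasurableSet (H n)) {p : ℝ≥0∞} (hp : ∀ n, p ≤ P (H n))
    (hHM : ∀ n, ∀ᵐ ω ∂P, ω ∈ H n →
      ∃ x ∈ K, ∃ y ∈ A, ∀ i, |M x ω i - y i| < 1 / ((n : ℝ) + 1)) :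
    p ≤ P {ω | (((fun x => M x ω) '' K) ∩ A).Nonempty} := by
  refine (le_measure_limsup hH hp).trans (measure_mono_ae ?_)
  filter_upwards [hcont, ae_all_iff.2 hHM] with ω hω hHω hmem
  have hfreq : ∀ n : ℕ, ∃ k ≥ n, ∃ x ∈ K, ∃ y ∈ A, ∀ i, |M x ω i - y i| < 1 / ((k : ℝ) + 1) := by
    intro n
    obtain ⟨k, hk, hkω⟩ := Set.mem_iUnion₂.1 (Set.mem_iInter.1 hmem n)
    exact ⟨k, hk, hHω k hkω⟩
  have hne : (K ×ˢ A).Nonempty := by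
    obtain ⟨_, _, x, hx, y, hy, _⟩ := hfreq 0
    exact ⟨(x, y), hx, hy⟩
  have hfc : ContinuousOn (fun p : EuclideanSpace ℝ (Fin d) × EuclideanSpace ℝ (Fin D) =>
      ‖M p.1 ω - p.2‖) (K ×ˢ A) :=
    ((hω.comp continuousOn_fst fun p hp => hp.1).sub continuousOn_snd).norm
  obtain ⟨⟨x, y⟩, ⟨hx, hy⟩, hmin⟩ := (hK.prod hA).exists_isMinOn hne hfc
  have hzero : ‖M x ω - y‖ ≤ 0 := by
    have hle : ∀ n : ℕ, ‖M x ω - y‖ ≤ D * (1 / ((n : ℝ) + 1)) := by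
      intro n
      obtain ⟨k, hk, x', hx', y', hy', hxy⟩ := hfreq n
      have h1 : ‖M x ω - y‖ ≤ ‖M x' ω - y'‖ := isMinOn_iff.1 hmin (x', y') ⟨hx', hy'⟩
      have h2 : ‖M x' ω - y'‖ ≤ D * (1 / ((k : ℝ) + 1)) := by
        refine euclidean_norm_le_card_mul (fun i => ?_) (by positivity)
        rw [PiLp.sub_apply]
        exact (hxy i).le
      have h3 : (1 : ℝ) / (k + 1) ≤ 1 / (n + 1) := Nat.one_div_le_one_div hk
      exact h1.trans (h2.trans (mul_le_mul_of_nonneg_left h3 (Nat.cast_nonneg D)))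
    have hlim := (tendsto_one_div_add_atTop_nhds_zero_nat (𝕜 := ℝ)).const_mul (D : ℝ)
    rw [mul_zero] at hlim
    exact ge_of_tendsto' hlim hle
  have heq : M x ω = y := by
    rw [← sub_eq_zero, ← norm_le_zero_iff]; exact hzero
  exact ⟨y, ⟨x, hx, heq⟩, hy⟩

/-- Fubini requires joint measurability. It holds once the paths are set to zero off a measurable
full-measure event of continuity. -/
theorem exists_measurable_modification {K : Set (EuclideanSpace ℝ (Fin d))}
    (hm : ∀ x, Measurable (M x)) (hcont : ∀ᵐ ω ∂P, ContinuousOn (fun x => M x ω) K) :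
    ∃ M' : K → Ω → EuclideanSpace ℝ (Fin D), Measurable (Function.uncurry M') ∧
      ∀ᵐ ω ∂P, ∀ x : K, M' x ω = M x ω := by
  obtain ⟨G, hG, hGm, hGc⟩ := hcont.exists_measurable_mem
  refine ⟨fun x => G.indicator (M x), ?_, ?_⟩
  · refine measurable_uncurry_of_continuous_of_measurable (fun ω => ?_)
      fun x => (hm x).indicator hGm
    by_cases hω : ω ∈ G
    · simp only [Set.indicator_of_mem hω]
      exact continuousOn_iff_continuous_domRestrict.1 (hGc ω hω)
    · simp only [Set.indicator_of_notMem hω]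
      exact continuous_const
  · filter_upwards [hG] with ω hω x
    exact Set.indicator_of_mem hω _

theorem sq_div_energy_le_measure_image_inter_nonempty [IsProbabilityMeasure P] [NeZero d]
    {K : Set (EuclideanSpace ℝ (Fin d))}
    (hK : IsCompact K) {A : Set (EuclideanSpace ℝ (Fin D))} (hA : IsCompact A)
    (hm : ∀ x, Measurable (M x)) (hcont : ∀ᵐ ω ∂P, ContinuousOn (fun x => M x ω) K)
    {μ : Measure (EuclideanSpace ℝ (Fin D))} [IsFiniteMeasure μ] (hμ : ∀ᵐ y ∂μ, y ∈ A)
    {k : EuclideanSpace ℝ (Fin D) → ℝ≥0∞} (hk : Measurable k) {α β : ℝ≥0∞}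
    (Ψ : EuclideanSpace ℝ (Fin d) → EuclideanSpace ℝ (Fin d) → EuclideanSpace ℝ (Fin D) → ℝ≥0∞)
    (h1 : ∀ x ∈ K, ∀ y ∈ A, ∀ ε : ℝ, 0 < ε → ε ≤ 1 →
      ENNReal.ofReal ε ^ D * α ≤ P {ω | ∀ i, |M x ω i - y i| < ε})
    (h2 : ∀ x ∈ K, ∀ x' ∈ K, x' ≠ x → ∀ y ∈ A, ∀ z ∈ A, ∀ ε : ℝ, 0 < ε → ε ≤ 1 →
      P {ω | ∀ i, |M x ω i - y i| < ε ∧ |M x' ω i - z i| < ε} ≤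
        (ENNReal.ofReal ε ^ D) ^ 2 * Ψ x x' (y - z))
    (h3 : ∀ x ∈ K, ∀ y ∈ A, ∀ z ∈ A, ∫⁻ x' in K, Ψ x x' (y - z) ≤ β * k (y - z)) :
    (α * volume K * μ Set.univ) ^ 2 / (β * volume K * energy k μ) ≤
      P {ω | (((fun x => M x ω) '' K) ∩ A).Nonempty} := by
  obtain ⟨M', hM', hMM'⟩ := exists_measurable_modification hm hcont
  set ν₀ : Measure K := Measure.comap Subtype.val volume with hν₀
  have hemb : MeasurableEmbedding (Subtype.val : K → EuclideanSpace ℝ (Fin d)) :=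
    MeasurableEmbedding.subtype_coe hK.measurableSet
  have hν₀u : ν₀ Set.univ = volume K := by
    rw [hν₀, hemb.comap_apply, Set.image_univ, Subtype.range_coe]
  have : IsFiniteMeasure ν₀ := ⟨by rw [hν₀u]; exact hK.measure_lt_top⟩
  -- The diagonal, where the two-point bound is unavailable, is Lebesgue-null because d ≥ 1.
  have hν₀s : ∀ x : K, ∀ᵐ x' ∂ν₀, x' ≠ x := by
    intro x
    have hset : {x' : K | ¬ x' ≠ x} = {x} := by ext; simp
    rw [ae_iff, hset, hν₀, hemb.comap_apply, Set.image_singleton]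
    have : Nonempty (Fin d) := ⟨0⟩
    exact measure_singleton _
  set B : ℝ → Set ((K × EuclideanSpace ℝ (Fin D)) × Ω) := fun ε =>
    {p | p.1.2 ∈ A ∧ ∀ i, |M' p.1.1 p.2 i - p.1.2 i| < ε} with hB
  have hBm : ∀ ε, MeasurableSet (B ε) := by
    intro ε
    have hM'2 : Measurable fun p : (K × EuclideanSpace ℝ (Fin D)) × Ω => M' p.1.1 p.2 :=
      hM'.comp (f := fun p : (K × EuclideanSpace ℝ (Fin D)) × Ω => (p.1.1, p.2)) (by fun_prop)
    have e1 : MeasurableSet {p : (K × EuclideanSpace ℝ (Fin D)) × Ω | p.1.2 ∈ A} :=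
      (show Measurable fun p : (K × EuclideanSpace ℝ (Fin D)) × Ω => p.1.2 by fun_prop)
        hA.measurableSet
    have e2 : MeasurableSet {p : (K × EuclideanSpace ℝ (Fin D)) × Ω |
        ∀ i, |M' p.1.1 p.2 i - p.1.2 i| < ε} := by
      rw [Set.ofPred_forall]
      exact MeasurableSet.iInter fun i => measurableSet_lt (by fun_prop) measurable_const
    exact e1.inter e2
  have main : ∀ ε : ℝ, 0 < ε → ε ≤ 1 → ∃ H, MeasurableSet H ∧
      (∀ᵐ ω ∂P, ω ∈ H → ∃ x ∈ K, ∃ y ∈ A, ∀ i, |M x ω i - y i| < ε) ∧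
      (α * volume K * μ Set.univ) ^ 2 ≤ β * volume K * energy k μ * P H := by
    intro ε hε hε1
    set e := ENNReal.ofReal ε ^ D with he
    have he0 : e ^ 2 ≠ 0 := by
      have : ENNReal.ofReal ε ≠ 0 := by simpa using hε
      positivity
    have het : e ^ 2 ≠ ∞ := by
      rw [he]; exact ENNReal.pow_ne_top (ENNReal.pow_ne_top ENNReal.ofReal_ne_top)
    have hfirst : ∀ᵐ t ∂(ν₀.prod μ), e * α ≤ P {ω | (t, ω) ∈ B ε} := by
      have hμ2 : ∀ᵐ t ∂(ν₀.prod μ), t.2 ∈ A := Measure.quasiMeasurePreserving_snd.ae hμ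
      filter_upwards [hμ2] with t ht
      refine (h1 t.1 t.1.2 t.2 ht ε hε hε1).trans (measure_mono_ae ?_)
      filter_upwards [hMM'] with ω hω hmem
      refine ⟨ht, fun i => ?_⟩
      have := hmem i
      rwa [← hω] at this
    have hpair : ∀ (x : K) (y : EuclideanSpace ℝ (Fin D)), y ∈ A → ∀ z ∈ A,
        ∫⁻ x' : K, P {ω | ((x, y), ω) ∈ B ε ∧ ((x', z), ω) ∈ B ε} ∂ν₀ ≤
          e ^ 2 * (β * k (y - z)) := by
      intro x y hy z hz
      calc ∫⁻ x' : K, P {ω | ((x, y), ω) ∈ B ε ∧ ((x', z), ω) ∈ B ε} ∂ν₀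
          ≤ ∫⁻ x' : K, e ^ 2 * Ψ x x' (y - z) ∂ν₀ := by
            refine lintegral_mono_ae ?_
            filter_upwards [hν₀s x] with x' hx'
            refine le_trans (measure_mono_ae ?_) (h2 x x.2 x' x'.2
              (fun h => hx' (Subtype.ext h)) y hy z hz ε hε hε1)
            filter_upwards [hMM'] with ω hω hmem i
            have ha := hmem.1.2 i
            have hb := hmem.2.2 i
            simp only [hω] at ha hb
            exact ⟨ha, hb⟩
        _ = e ^ 2 * ∫⁻ x' in K, Ψ x x' (y - z) := by
            rw [lintegral_const_mul' _ _ het, hν₀,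
              lintegral_subtype_comap hK.measurableSet (fun x' => Ψ x x' (y - z))]
        _ ≤ _ := by
            gcongr
            exact h3 x x.2 y hy z hz
    have hsecond : ∫⁻ p, P {ω | (p.1, ω) ∈ B ε ∧ (p.2, ω) ∈ B ε} ∂((ν₀.prod μ).prod (ν₀.prod μ)) ≤
        e ^ 2 * (β * volume K * energy k μ) := by
      have hFm : Measurable fun p : (K × EuclideanSpace ℝ (Fin D)) × (K × EuclideanSpace ℝ (Fin D)) =>
          P {ω | (p.1, ω) ∈ B ε ∧ (p.2, ω) ∈ B ε} := by
        refine measurable_measure_prodMk_left (s := {p : ((K × EuclideanSpace ℝ (Fin D)) ×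
          (K × EuclideanSpace ℝ (Fin D))) × Ω | (p.1.1, p.2) ∈ B ε ∧ (p.1.2, p.2) ∈ B ε}) ?_
        have e1 : Measurable fun p : ((K × EuclideanSpace ℝ (Fin D)) ×
          (K × EuclideanSpace ℝ (Fin D))) × Ω => (p.1.1, p.2) := by fun_prop
        have e2 : Measurable fun p : ((K × EuclideanSpace ℝ (Fin D)) ×
          (K × EuclideanSpace ℝ (Fin D))) × Ω => (p.1.2, p.2) := by fun_prop
        exact (e1 (hBm ε)).inter (e2 (hBm ε))
      rw [lintegral_prod _ hFm.aemeasurable]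
      calc ∫⁻ t, ∫⁻ s, P {ω | (t, ω) ∈ B ε ∧ (s, ω) ∈ B ε} ∂(ν₀.prod μ) ∂(ν₀.prod μ)
          ≤ ∫⁻ t, ∫⁻ z, e ^ 2 * (β * k (t.2 - z)) ∂μ ∂(ν₀.prod μ) := by
            refine lintegral_mono_ae ?_
            have hμ2 : ∀ᵐ t ∂(ν₀.prod μ), t.2 ∈ A := Measure.quasiMeasurePreserving_snd.ae hμ
            filter_upwards [hμ2] with t ht
            rw [lintegral_prod_symm (fun s => P {ω | (t, ω) ∈ B ε ∧ (s, ω) ∈ B ε})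
              (hFm.comp measurable_prodMk_left).aemeasurable]
            refine lintegral_mono_ae ?_
            filter_upwards [hμ] with z hz
            exact hpair t.1 t.2 ht z hz
        _ = ∫⁻ _ : K, ∫⁻ y, ∫⁻ z, e ^ 2 * (β * k (y - z)) ∂μ ∂μ ∂ν₀ := by
            have hmk : Measurable fun p : EuclideanSpace ℝ (Fin D) × EuclideanSpace ℝ (Fin D) =>
              e ^ 2 * (β * k (p.1 - p.2)) := by fun_prop
            have hmk2 : Measurable fun y => ∫⁻ z, e ^ 2 * (β * k (y - z)) ∂μ :=
              hmk.lintegral_prod_right'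
            rw [lintegral_prod (fun t : K × EuclideanSpace ℝ (Fin D) =>
              ∫⁻ z, e ^ 2 * (β * k (t.2 - z)) ∂μ) (hmk2.comp measurable_snd).aemeasurable]
        _ = _ := by
            have hmk : Measurable fun p : EuclideanSpace ℝ (Fin D) × EuclideanSpace ℝ (Fin D) =>
              k (p.1 - p.2) := by fun_prop
            rw [lintegral_const, hν₀u, energy,
              ← lintegral_prod (fun p : EuclideanSpace ℝ (Fin D) × EuclideanSpace ℝ (Fin D) =>
                e ^ 2 * (β * k (p.1 - p.2))) (by fun_prop),
              lintegral_const_mul _ (by fun_prop), lintegral_const_mul _ hmk]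
            ring
    obtain ⟨H, hHm, hH, hle⟩ := exists_measurableSet_of_second_moment (hBm ε) hfirst hsecond
    refine ⟨H, hHm, ?_, ?_⟩
    · filter_upwards [hMM'] with ω hω hmem
      obtain ⟨t, ht1, ht2⟩ := hH ω hmem
      refine ⟨t.1, t.1.2, t.2, ht1, fun i => ?_⟩
      have := ht2 i
      rwa [hω] at this
    · rw [← Set.univ_prod_univ, Measure.prod_prod, hν₀u] at hle
      -- The factor ε^(2D) is common to both moments; cancelling it makes the bound uniform in ε.
      rw [← ENNReal.mul_le_mul_iff_right he0 het]
      calc e ^ 2 * (α * volume K * μ Set.univ) ^ 2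
          = (e * α * (volume K * μ Set.univ)) ^ 2 := by ring
        _ ≤ _ := hle
        _ = _ := by ring
  have hpos : ∀ n : ℕ, (0 : ℝ) < 1 / ((n : ℝ) + 1) := fun n => by positivity
  have hone : ∀ n : ℕ, 1 / ((n : ℝ) + 1) ≤ 1 := fun n => by
    rw [div_le_one (by positivity)]
    linarith [(Nat.cast_nonneg n : (0 : ℝ) ≤ n)]
  choose H hHm hHM hHle using fun n : ℕ => main (1 / ((n : ℝ) + 1)) (hpos n) (hone n)
  exact le_measure_image_inter_nonempty hK hA hcont hHm
    (fun n => ENNReal.div_le_of_le_mul' (hHle n)) hHM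

end Field

/-! ### Localisation, constants and conclusion -/

/-- The last condition holds for small u because η > 0 makes u^(1+η) negligible against u. -/
theorem exists_pos_forall_lt_bounds {a b c₁ c₃ η L : ℝ} (ha : 0 < a) (hb : 0 < b) (hc₁ : 0 < c₁)
    (hη : 0 < η) (hL : 0 < L) :
    ∃ u₀ : ℝ, 0 < u₀ ∧ ∀ u, 0 < u → u < u₀ → u ≤ 1 ∧ (b * u) ^ 2 ≤ 2 * c₁ ∧
      c₃ * ((b + L) * u) ^ (1 + η) ≤ a * √c₁ * u := by
  have h1 : ∀ᶠ u in nhds (0 : ℝ), u < 1 := gt_mem_nhds one_pos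
  have h2 : ∀ᶠ u in nhds (0 : ℝ), (b * u) ^ 2 < 2 * c₁ := by
    have hc : ContinuousAt (fun u : ℝ => (b * u) ^ 2) 0 := by fun_prop
    exact hc.eventually (gt_mem_nhds (by simpa using hc₁))
  have h3 : ∀ᶠ u in nhds (0 : ℝ), c₃ * (b + L) * ((b + L) * u) ^ η < a * √c₁ := by
    have hc : ContinuousAt (fun u : ℝ => c₃ * (b + L) * ((b + L) * u) ^ η) 0 := by
      refine continuousAt_const.mul ?_
      exact ContinuousAt.rpow_const (by fun_prop) (Or.inr hη.le)
    refine hc.eventually (gt_mem_nhds ?_)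
    simp only [mul_zero, Real.zero_rpow hη.ne']
    positivity
  obtain ⟨u₀, hu₀, h⟩ := Metric.eventually_nhds_iff.1 (h1.and (h2.and h3))
  refine ⟨u₀, hu₀, fun u hu huu => ?_⟩
  obtain ⟨g1, g2, g3⟩ := h (y := u) (by rwa [Real.dist_eq, sub_zero, abs_of_pos hu])
  refine ⟨g1.le, g2.le, ?_⟩
  have hpos : 0 < (b + L) * u := by positivity
  rw [Real.rpow_add hpos, Real.rpow_one]
  calc c₃ * ((b + L) * u * ((b + L) * u) ^ η) = c₃ * (b + L) * ((b + L) * u) ^ η * u := by ring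
    _ ≤ _ := by gcongr

theorem exists_isCompact_subset_dist_lt {d : ℕ} {K : Set (EuclideanSpace ℝ (Fin d))}
    (hK : IsCompact K) (hKpos : 0 < volume K) {ρ : ℝ} (hρ : 0 < ρ) :
    ∃ K₁ ⊆ K, IsCompact K₁ ∧ 0 < volume K₁ ∧ ∀ x ∈ K₁, ∀ y ∈ K₁, dist x y < ρ := by
  obtain ⟨x₀, -, hx₀⟩ := exists_mem_forall_mem_nhdsWithin_pos_measure hKpos.ne'
  refine ⟨K ∩ Metric.closedBall x₀ (ρ / 3), Set.inter_subset_left,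
    hK.inter_right Metric.isClosed_closedBall, hx₀ _ ?_, fun x hx y hy => ?_⟩
  · exact Filter.inter_mem self_mem_nhdsWithin
      (mem_nhdsWithin_of_mem_nhds (Metric.closedBall_mem_nhds x₀ (by positivity)))
  · have h1 := Metric.mem_closedBall.1 hx.2
    have h2 := Metric.mem_closedBall.1 hy.2
    linarith [dist_triangle_right x y x₀]

theorem diam_pos_of_volume_pos {d : ℕ} [NeZero d] {K : Set (EuclideanSpace ℝ (Fin d))}
    (hK : IsCompact K) (hKpos : 0 < volume K) : 0 < Metric.diam K := by
  refine Metric.diam_pos ?_ hK.isBounded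
  by_contra h
  have : Nonempty (Fin d) := ⟨0⟩
  exact hKpos.ne' ((Set.not_nontrivial_iff.1 h).measure_zero volume)

theorem energy_restrict_le {D : ℕ} (k : EuclideanSpace ℝ (Fin D) → ℝ≥0∞)
    (μ : Measure (EuclideanSpace ℝ (Fin D))) [SFinite μ] (s : Set (EuclideanSpace ℝ (Fin D))) :
    energy k (μ.restrict s) ≤ energy k μ := by
  rw [energy, Measure.prod_restrict]
  exact setLIntegral_le_lintegral _ _

theorem theorems2 {d D : ℕ} [NeZero d] [NeZero D]
    (K : Set (EuclideanSpace ℝ (Fin d))) (hK : IsCompact K) (hKpos : 0 < volume K)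
    (N : ℝ) (hN : 0 < N)
    (f : EuclideanSpace ℝ (Fin d) → EuclideanSpace ℝ (Fin D))
    (r : ℝ≥0∞) (q : ℝ → ℝ) (hq : IsGauge r q)
    (hr : ENNReal.ofReal (Metric.diam K) < r)
    (hsup_pos : 0 < (⨆ τ ∈ Set.Ioc (0 : ℝ) (Metric.diam K),
      gaugeV d D r q (Metric.diam K) τ * gaugeG d D r q τ))
    (hsup_lt : (⨆ τ ∈ Set.Ioc (0 : ℝ) (Metric.diam K),
      gaugeV d D r q (Metric.diam K) τ * gaugeG d D r q τ) < ∞)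
    (c₁ c₂ c₃ η a b L : ℝ) (hc₁ : 0 < c₁) (hc₂ : 0 < c₂) (hc₃ : 0 < c₃) (hη : 0 < η)
    (ha : 0 < a) (hb : 0 < b) (hL : 0 < L) :
    ∃ C : ℝ, 0 < C ∧
      ∀ (Ω : Type*) [MeasurableSpace Ω] (P : Measure Ω) [IsProbabilityMeasure P]
        (M : EuclideanSpace ℝ (Fin d) → Ω → EuclideanSpace ℝ (Fin D)),
        (∀ x, Measurable (M x)) →
        IsGaussianProcess M P →
        IIDComponents P M →
        (∀ᵐ ω ∂P, ContinuousOn (fun x => M x ω) K) →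
        (∀ x ∈ K, meanFn P M x = f x) →
        HypHM P M K q c₁ c₂ c₃ η a b L →
        ∀ A : Set (EuclideanSpace ℝ (Fin D)), MeasurableSet A → A ⊆ Metric.ball 0 N →
          ENNReal.ofReal C * kernelCapacity (gaugeKernel d D r q) A ≤
            P {ω | (((fun x => M x ω) '' K) ∩ A).Nonempty} := by
  have hδ := diam_pos_of_volume_pos hK hKpos
  set δ := Metric.diam K with hδdef
  obtain ⟨u₀, hu₀, hu⟩ := exists_pos_forall_lt_bounds (c₃ := c₃) ha hb hc₁ hη hL
  obtain ⟨s₀, hs₀, hs₀r, hqs₀⟩ := hq.exists_pos_map_lt hu₀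
  obtain ⟨K₁, hK₁K, hK₁, hK₁pos, hK₁d⟩ :=
    exists_isCompact_subset_dist_lt hK hKpos (lt_min hs₀ hδ)
  have hK₁δ : ∀ x ∈ K₁, ∀ z ∈ K₁, dist x z < δ := fun x hx z hz =>
    (hK₁d x hx z hz).trans_le (min_le_right _ _)
  have hqpos : ∀ x ∈ K₁, ∀ z ∈ K₁, z ≠ x → 0 < q (dist x z) ∧ q (dist x z) < u₀ := by
    intro x hx z hz hne
    have h0 : 0 < dist x z := dist_pos.2 hne.symm
    have h1 : dist x z < s₀ := (hK₁d x hx z hz).trans_le (min_le_left _ _)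
    have hm : dist x z ∈ {s : ℝ | 0 ≤ s ∧ ENNReal.ofReal s < r} :=
      ⟨h0.le, (ENNReal.ofReal_le_ofReal h1.le).trans_lt hs₀r⟩
    constructor
    · rw [← hq.map_zero]
      exact hq.strictMonoOn (by simp [hq.pos]) hm h0
    · exact (hq.strictMonoOn hm ⟨hs₀.le, hs₀r⟩ h1).trans hqs₀
  obtain ⟨x₀, hx₀⟩ := nonempty_of_measure_ne_zero hK₁pos.ne'
  -- Bounds the mean on K₁, where its distance to f(x₀) is at most L q ≤ L.
  set F : ℝ := ‖f x₀‖ + L with hF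
  have hB : 0 ≤ N + F := by positivity
  obtain ⟨Cp, hCp, hpair⟩ := exists_measure_forall_abs_sub_lt_le (d := d) (D := D) (q := q)
    (η := η) hc₁ hc₂ hc₃ hη ha hb hL hB
  obtain ⟨Cg, hCg, hgauge⟩ :=
    exists_lintegral_potential_le (d := d) (D := D) hq hδ hr hsup_lt (2 * N)
  set V := (volume K₁).toReal with hV
  have hVe : ENNReal.ofReal V = volume K₁ := ENNReal.ofReal_toReal hK₁.measure_lt_top.ne
  have hV0 : 0 < V := ENNReal.toReal_pos hK₁pos.ne' hK₁.measure_lt_top.ne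
  set κ : ℝ := 2 * ((√(2 * Real.pi * c₂))⁻¹ * Real.exp (-(N + F + 1) ^ 2 / (2 * c₁))) with hκ
  have hκ0 : 0 < κ := by positivity
  -- The ratio (first moment)² / second moment, with 1/2 for the μ-mass kept by the compact part of
  -- A.
  refine ⟨(κ ^ D * V * (1 / 2)) ^ 2 / (Cp ^ D * Cg * V), by positivity, ?_⟩
  intro Ω _ P _ M hm hM hI hcont hf hH A hA hAN
  have hmean : ∀ x ∈ K₁, ∀ z ∈ A, ∀ i, |z i - meanFn P M x 0| ≤ N + F := by
    intro x hx z hz i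
    have h1 : ‖z‖ ≤ N := (mem_ball_zero_iff.1 (hAN hz)).le
    have h2 : dist (meanFn P M x) (meanFn P M x₀) ≤ L := by
      by_cases hxx : x₀ = x
      · rw [hxx, dist_self]; exact hL.le
      · obtain ⟨h3, h4⟩ := hqpos x hx x₀ hx₀ hxx
        refine (hH.mean_sub x (hK₁K hx) x₀ (hK₁K hx₀)).trans ?_
        exact mul_le_of_le_one_right hL.le (hu _ h3 h4).1
    have h3 : ‖meanFn P M x‖ ≤ F := by
      rw [hF, ← hf x₀ (hK₁K hx₀)]
      rw [dist_eq_norm] at h2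
      linarith [norm_le_norm_add_norm_sub' (meanFn P M x) (meanFn P M x₀)]
    have h4 := PiLp.norm_apply_le z i
    have h5 := PiLp.norm_apply_le (meanFn P M x) 0
    rw [Real.norm_eq_abs] at h4 h5
    linarith [abs_sub (z i) (meanFn P M x 0)]
  rw [kernelCapacity, ENNReal.inv_iInf, ENNReal.mul_iSup]
  refine iSup_le fun μ => ?_
  rw [ENNReal.inv_iInf, ENNReal.mul_iSup]
  refine iSup_le fun ⟨hμ, hμA⟩ => ?_
  have hμA1 : μ A = 1 := (prob_compl_eq_zero_iff hA).1 hμA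
  obtain ⟨A₁, hA₁A, hA₁, hμA₁⟩ := hA.exists_lt_isCompact_of_ne_top (measure_ne_top μ A)
    (r := ENNReal.ofReal (1 / 2)) (by rw [hμA1]; norm_num)
  have hcore := sq_div_energy_le_measure_image_inter_nonempty hK₁ hA₁ hm
    (hcont.mono fun ω hω => hω.mono hK₁K) (μ := μ.restrict A₁)
    (ae_restrict_mem hA₁.measurableSet) (measurable_gaugeKernel (d := d) (D := D) (r := r) (q := q))
    (α := ENNReal.ofReal (κ ^ D)) (β := ENNReal.ofReal (Cp ^ D * Cg))
    (fun x x' w => ENNReal.ofReal (Cp ^ D) * (ENNReal.ofReal (max (q (dist x x')) ‖w‖) ^ D)⁻¹)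
    ?_ ?_ ?_
  · calc ENNReal.ofReal ((κ ^ D * V * (1 / 2)) ^ 2 / (Cp ^ D * Cg * V)) *
          (energy (gaugeKernel d D r q) μ)⁻¹
        = ENNReal.ofReal (κ ^ D * V * (1 / 2)) ^ 2 /
            (ENNReal.ofReal (Cp ^ D * Cg * V) * energy (gaugeKernel d D r q) μ) := by
          rw [ENNReal.ofReal_div_of_pos (by positivity), ENNReal.ofReal_pow (by positivity),
            ENNReal.div_eq_inv_mul, ENNReal.div_eq_inv_mul, ENNReal.mul_inv]
          · ring
          · exact Or.inl (ENNReal.ofReal_pos.2 (by positivity)).ne'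
          · exact Or.inl ENNReal.ofReal_ne_top
      _ ≤ _ := by
          refine le_trans ?_ (hcore.trans (measure_mono ?_))
          · rw [ENNReal.ofReal_mul (by positivity), ENNReal.ofReal_mul (by positivity),
              ENNReal.ofReal_mul (by positivity : 0 ≤ Cp ^ D * Cg), hVe,
              Measure.restrict_apply_univ]
            gcongr
            exact energy_restrict_le _ _ _
          · rintro ω ⟨y, ⟨x, hx, rfl⟩, hy⟩
            exact ⟨_, ⟨x, hK₁K hx, rfl⟩, hA₁A hy⟩
  · intro x hx y hy ε hε hε1
    refine le_trans (le_of_eq ?_) (le_measure_forall_abs_sub_lt hM hI hc₁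
      (hH.var_bounds x (hK₁K hx)).1 (hH.var_bounds x (hK₁K hx)).2 hε1
      (hmean x hx y (hA₁A hy)))
    rw [ENNReal.ofReal_pow hκ0.le, ← mul_pow, ← ENNReal.ofReal_mul hε.le]
    congr 2
    rw [hκ]; ring
  · intro x hx x' hx' hne y hy z hz ε hε hε1
    obtain ⟨h1, h2⟩ := hqpos x hx x' hx' hne
    obtain ⟨h3, h4, h5⟩ := hu _ h1 h2
    refine (hpair K hM hI hH x (hK₁K hx) x' (hK₁K hx') h1 h3 h4 h5 y z ε
      (hmean x' hx' z (hA₁A hz)) hε hε1).trans (le_of_eq ?_)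
    have hmax : 0 < max (q (dist x x')) ‖y - z‖ := lt_max_of_lt_left h1
    rw [← ENNReal.ofReal_pow hε.le, ← ENNReal.ofReal_pow (by positivity),
      ← ENNReal.ofReal_pow hmax.le, ← ENNReal.ofReal_inv_of_pos (by positivity),
      ← ENNReal.ofReal_mul (by positivity), ← ENNReal.ofReal_mul (by positivity), div_pow, mul_pow,
      div_eq_mul_inv]
    congr 1
    ring
  · intro x hx y hy z hz
    -- The potential bound needs τ > 0; at τ = 0 the kernel is infinite by definition.
    by_cases hyz : y - z = 0
    · have : gaugeKernel d D r q (y - z) = ∞ := by simp [gaugeKernel, hyz]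
      rw [this, ENNReal.mul_top (by simp; positivity)]
      exact le_top
    · have hk : gaugeKernel d D r q (y - z) = (gaugeG d D r q ‖y - z‖)⁻¹ := by
        simp [gaugeKernel, hyz]
      rw [hk, lintegral_const_mul' _ _ ENNReal.ofReal_ne_top, ENNReal.ofReal_mul (by positivity),
        mul_assoc]
      gcongr
      refine hgauge _ (norm_pos_iff.2 hyz) ?_ K₁ x hK₁.measurableSet (hK₁δ x hx)
      have h1 : ‖y‖ < N := mem_ball_zero_iff.1 (hAN (hA₁A hy))
      have h2 : ‖z‖ < N := mem_ball_zero_iff.1 (hAN (hA₁A hz))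
      linarith [norm_sub_le y z]
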